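/- For $L>0$ let $\Lambda_L=[-L/2,L/2)^3$, let $\mathfrak F_L=\bigoplus_{n\ge 0}L^2_{\mathrm{sym}}(\Lambda_L^n)$ be the symmetric Fock space over $L^2(\Lambda_L)$, and let $(\mathcal N\psi)^{(n)}=n\,\psi^{(n)}$ be the number operator with its maximal domain $D(\mathcal N)$. Inner products are antilinear in the first argument. For $f\in L^2(\Lambda_L)$ let $a(f)$, $a^*(f)$ be the annihilation and creation operators on $D(\mathcal N^{1/2})$, $$(a(f)\psi)^{(n)}(x_1,\dots,x_n)=\sqrt{n+1}\int_{\Lambda_L}\overline{f(x)}\,\psi^{(n+1)}(x,x_1,\dots,x_n)\,dx,$$ $$(a^*(f)\psi)^{(n)}(x_1,\dots,x_n)=\frac1{\sqrt n}\sum_{j=1}^n f(x_j)\,\psi^{(n-1)}(x_1,\dots,x_{j-1},x_{j+1},\dots,x_n),\qquad (a^*(f)\psi)^{(0)}=0.$$ Let $\phi(f)=a(f)+a^*(f)$ on $D(\mathcal N^{1/2})$, and let $\mathcal W(f)=e^{-i\phi(if)}$ be the unitary Weyl operator (the exponential being that of the self-adjoint closure of $\phi(if)$). For a symmetric operator $A$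 and $\psi\in D(A)$ put $\mathbb E_\psi[A]=\langle\psi,A\psi\rangle$ and $\mathrm{Var}_\psi[A]=\|A\psi\|^2-(\mathbb E_\psi[A])^2$. All objects below are families indexed by $\varrho,L>0$, and "$q_{\varrho,L}\to0$ in the iterated limit" means $\lim_{\varrho\to\infty}\limsup_{L\to\infty}q_{\varrho,L}=0$. * Given non-zero $f_{\varrho,L}\in L^2(\Lambda_L)$, vectors $\Omega_{\varrho,L}\in D(\mathcal N)$ are a *quasi-vacuum state with respect to $f_{\varrho,L}$* if $\|\Omega_{\varrho,L}\|=1$ for all $\varrho,L>0$ and, in the iterated limit, $$\frac{\|\mathcal N^{1/2}\Omega_{\varrho,L}\|}{\|f_{\varrho,L}\|_2}\to0,\qquad \left|\frac{\mathrm{Var}_{\Omega_{\varrho,L}}[\mathcal N+\phi(f_{\varrho,L})]}{\|f_{\varrho,L}\|_2^2}-1\right|\to0 .$$ * Given $g_{\varrho,L}\in L^2(\Lambda_L)$ with $\|g_{\varrho,L}\|_2=1$ for all $\varrho,L>0$, vectors $\phi_{\varrho,L}\in D(\mathcal N)$ are a *quasi-eigenstate of $a(g_{\varrho,L})$ with quasi-eigenvalue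 $z_{\varrho,L}\in\mathbb C$* if, in the iterated limit, $$\frac{\|(a(g_{\varrho,L})-z_{\varrho,L})\phi_{\varrho,L}\|}{\|\mathcal N^{1/2}\phi_{\varrho,L}\|}\to0 .$$ * Vectors $\phi_{\varrho,L}\in D(\mathcal N)$ are a *quasi-canonical coherent state* if $\|\phi_{\varrho,L}\|=1$ for all $\varrho,L>0$; in the iterated limit, $$\left|\frac{\mathbb E_{\phi_{\varrho,L}}[\mathcal N]}{\varrho L^3}-1\right|\to0,\qquad \left|\frac{\mathrm{Var}_{\phi_{\varrho,L}}[\mathcal N]}{\varrho L^3}-1\right|\to0;$$ and for every family $g_{\varrho,L}\in L^2(\Lambda_L)$ with $\|g_{\varrho,L}\|_2=1$ for all $\varrho,L>0$ there are $z_{\varrho,L}\in\mathbb C$ such that $\phi_{\varrho,L}$ is a quasi-eigenstate of $a(g_{\varrho,L})$ with quasi-eigenvalue $z_{\varrho,L}$. **Proposition.** Let $f_{\varrho,L}\in L^2(\Lambda_L)$ satisfy $\|f_{\varrho,L}\|_2^2=\varrho L^3$ for all $\varrho,L>0$, and let $\Omega_{\varrho,L}\in D(\mathcal N)$ be a quasi-vacuum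 state with respect to $f_{\varrho,L}$. Then $\phi_{\varrho,L}=\mathcal W(f_{\varrho,L})\,\Omega_{\varrho,L}$ is a quasi-canonical coherent state. Moreover, for every family $g_{\varrho,L}\in L^2(\Lambda_L)$ with $\|g_{\varrho,L}\|_2=1$ for all $\varrho,L>0$, $\phi_{\varrho,L}$ is a quasi-eigenstate of $a(g_{\varrho,L})$ with quasi-eigenvalue $\langle g_{\varrho,L},f_{\varrho,L}\rangle_2$. -/

import Mathlib

open MeasureTheory Filter Topology

noncomputable section

namespace BoseFock

/-! ### `n`-particle sectors

The one-particle space is `L²(X, μ)`; its `n`-fold Hilbert tensor power is `L²(Xⁿ, μⁿ)`. -/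

section Sectors

variable {X : Type*} [MeasurableSpace X] (μ : Measure X) [SigmaFinite μ]

/-- The one-particle Hilbert space `L²(X, μ; ℂ)`. -/
abbrev OneParticle : Type _ := Lp ℂ 2 μ

/-- The `n`-particle space `L²(Xⁿ, μⁿ; ℂ)`. -/
abbrev Sector (n : ℕ) : Type _ := Lp ℂ 2 (Measure.pi (fun _ : Fin n => μ))

theorem measurePreserving_perm {n : ℕ} (σ : Equiv.Perm (Fin n)) :
    MeasurePreserving (fun (x : Fin n → X) (i : Fin n) => x (σ i))
      (Measure.pi (fun _ : Fin n => μ)) (Measure.pi (fun _ : Fin n => μ)) := by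
  have h := (measurePreserving_piCongrLeft (fun _ : Fin n => μ) σ.symm)
  convert h using 1
  funext x i
  have := Equiv.piCongrLeft_apply (P := fun _ : Fin n => X) σ.symm x i
  simp [MeasurableEquiv.coe_piCongrLeft, this]

/-- The unitary action of a permutation, `(U_σ ψ)(x₁, …, xₙ) = ψ(x_{σ 1}, …, x_{σ n})`. -/
def permOp {n : ℕ} (σ : Equiv.Perm (Fin n)) : Sector μ n →ₗᵢ[ℂ] Sector μ n :=
  Lp.compMeasurePreservingₗᵢ ℂ _ (measurePreserving_perm μ σ)

theorem permOp_coeFn {n : ℕ} (σ : Equiv.Perm (Fin n)) (ψ : Sector μ n) :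
    permOp μ σ ψ =ᵐ[Measure.pi (fun _ : Fin n => μ)] fun x => ψ (fun i => x (σ i)) :=
  Lp.coeFn_compMeasurePreserving ψ (measurePreserving_perm μ σ)

theorem permOp_permOp {n : ℕ} (σ τ : Equiv.Perm (Fin n)) (ψ : Sector μ n) :
    permOp μ σ (permOp μ τ ψ) = permOp μ (σ * τ) ψ := by
  apply Lp.ext
  have h := (measurePreserving_perm μ σ).quasiMeasurePreserving.ae (permOp_coeFn μ τ ψ)
  filter_upwards [permOp_coeFn μ σ (permOp μ τ ψ), permOp_coeFn μ (σ * τ) ψ, h] with x h1 h2 h3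
  rw [h1, h2, h3]
  rfl

theorem permOp_one {n : ℕ} (ψ : Sector μ n) : permOp μ 1 ψ = ψ := by
  apply Lp.ext
  filter_upwards [permOp_coeFn μ 1 ψ] with x h1
  rw [h1]
  rfl

/-- The bosonic `n`-particle space: permutation invariant elements of `L²(Xⁿ)`. -/
def SymSector (n : ℕ) : Submodule ℂ (Sector μ n) where
  carrier := {ψ | ∀ σ : Equiv.Perm (Fin n), permOp μ σ ψ = ψ}
  add_mem' := fun ha hb σ => by rw [map_add, ha σ, hb σ]
  zero_mem' := fun σ => map_zero _
  smul_mem' := fun c ψ h σ => by rw [map_smul, h σ]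

theorem isClosed_symSector (n : ℕ) : IsClosed (SymSector μ n : Set (Sector μ n)) := by
  have : (SymSector μ n : Set (Sector μ n)) =
      ⋂ σ : Equiv.Perm (Fin n), {ψ | permOp μ σ ψ = ψ} := by
    ext ψ
    simp [SymSector]
  rw [this]
  exact isClosed_iInter fun σ => isClosed_eq (permOp μ σ).continuous continuous_id

instance (n : ℕ) : CompleteSpace (SymSector μ n) :=
  (isClosed_symSector μ n).completeSpace_coe

theorem mem_symSector {n : ℕ} {ψ : Sector μ n} :
    ψ ∈ SymSector μ n ↔ ∀ σ : Equiv.Perm (Fin n), permOp μ σ ψ = ψ := Iff.rfl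

theorem average_mem_symSector (n : ℕ) (ψ : Sector μ n) :
    (((n.factorial : ℂ)⁻¹) • ∑ σ : Equiv.Perm (Fin n),
      (permOp μ σ).toContinuousLinearMap) ψ ∈ SymSector μ n := by
  rw [mem_symSector]
  intro τ
  simp only [smul_apply, sum_apply,
    LinearIsometry.coe_toContinuousLinearMap, map_smul, map_sum, permOp_permOp]
  congr 1
  exact Fintype.sum_equiv (Equiv.mulLeft τ) _ _ (fun σ => rfl)

/-- The symmetrisation operator `Sₙ = (1/n!) ∑_σ U_σ`. -/
def symmetrize (n : ℕ) : Sector μ n →L[ℂ] SymSector μ n :=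
  (((n.factorial : ℂ)⁻¹) • ∑ σ : Equiv.Perm (Fin n),
      (permOp μ σ).toContinuousLinearMap).codRestrict (SymSector μ n) (average_mem_symSector μ n)

theorem coe_symmetrize (n : ℕ) (ψ : Sector μ n) : (symmetrize μ n ψ : Sector μ n) =
    ((n.factorial : ℂ)⁻¹) • ∑ σ : Equiv.Perm (Fin n), permOp μ σ ψ := by
  rw [symmetrize, ContinuousLinearMap.coe_codRestrict_apply]
  simp only [smul_apply, sum_apply, LinearIsometry.coe_toContinuousLinearMap]

/-! ### One-body creation and annihilation on the unsymmetrised tensor powers -/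

theorem measurePreserving_cons (n : ℕ) :
    MeasurePreserving (fun x : Fin (n + 1) → X => (x 0, fun i : Fin n => x i.succ))
      (Measure.pi (fun _ : Fin (n + 1) => μ)) (μ.prod (Measure.pi (fun _ : Fin n => μ))) := by
  have h := measurePreserving_piFinSuccAbove (fun _ : Fin (n + 1) => μ) 0
  exact h

theorem memLp_tensor {n : ℕ} (f : OneParticle μ) (ψ : Sector μ n) :
    MemLp (fun x : Fin (n + 1) → X => f (x 0) * ψ (fun i : Fin n => x i.succ)) 2
      (Measure.pi (fun _ : Fin (n + 1) => μ)) := by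
  have hf := Lp.memLp f
  have hψ := Lp.memLp ψ
  have h1 : AEStronglyMeasurable (fun p : X × (Fin n → X) => f p.1 * ψ p.2)
      (μ.prod (Measure.pi (fun _ : Fin n => μ))) :=
    (hf.1.comp_fst).mul (hψ.1.comp_snd)
  have h2 : MemLp (fun p : X × (Fin n → X) => f p.1 * ψ p.2) 2
      (μ.prod (Measure.pi (fun _ : Fin n => μ))) := by
    rw [memLp_two_iff_integrable_sq_norm h1]
    simp only [norm_mul, mul_pow]
    exact ((memLp_two_iff_integrable_sq_norm hf.1).1 hf).mul_prod
      ((memLp_two_iff_integrable_sq_norm hψ.1).1 hψ)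
  exact h2.comp_measurePreserving (measurePreserving_cons μ n)

/-- `f ⊗ ψ`, i.e. `(x₀, x₁, …, xₙ) ↦ f(x₀) ψ(x₁, …, xₙ)`. -/
def tensor {n : ℕ} (f : OneParticle μ) (ψ : Sector μ n) : Sector μ (n + 1) :=
  (memLp_tensor μ f ψ).toLp _

theorem tensor_coeFn {n : ℕ} (f : OneParticle μ) (ψ : Sector μ n) :
    tensor μ f ψ =ᵐ[Measure.pi (fun _ : Fin (n + 1) => μ)]
      fun x => f (x 0) * ψ (fun i : Fin n => x i.succ) :=
  MemLp.coeFn_toLp _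

theorem quasi_tail (n : ℕ) :
    Measure.QuasiMeasurePreserving (fun (x : Fin (n + 1) → X) (i : Fin n) => x i.succ)
      (Measure.pi (fun _ : Fin (n + 1) => μ)) (Measure.pi (fun _ : Fin n => μ)) :=
  (Measure.quasiMeasurePreserving_snd (μ := μ) (ν := Measure.pi (fun _ : Fin n => μ))).comp
    (measurePreserving_cons μ n).quasiMeasurePreserving

theorem inner_tensor {n : ℕ} (f g : OneParticle μ) (φ ψ : Sector μ n) :
    inner ℂ (tensor μ f φ) (tensor μ g ψ) = inner ℂ f g * inner ℂ φ ψ := by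
  simp only [L2.inner_def]
  rw [← integral_prod_mul, ← (measurePreserving_cons μ n).map_eq]
  have h1 : AEStronglyMeasurable
      (fun p : X × (Fin n → X) => inner ℂ (f p.1) (g p.1) * inner ℂ (φ p.2) (ψ p.2))
      (Measure.map (fun x : Fin (n + 1) → X => (x 0, fun i : Fin n => x i.succ))
        (Measure.pi (fun _ : Fin (n + 1) => μ))) := by
    rw [(measurePreserving_cons μ n).map_eq]
    exact ((Lp.memLp f).1.inner (Lp.memLp g).1).comp_fst.mul
      ((Lp.memLp φ).1.inner (Lp.memLp ψ).1).comp_snd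
  rw [integral_map (measurePreserving_cons μ n).measurable.aemeasurable h1]
  apply integral_congr_ae
  filter_upwards [tensor_coeFn μ f φ, tensor_coeFn μ g ψ] with x h1 h2
  rw [h1, h2]
  simp only [RCLike.inner_apply, map_mul]
  ring

theorem norm_tensor {n : ℕ} (f : OneParticle μ) (ψ : Sector μ n) :
    ‖tensor μ f ψ‖ = ‖f‖ * ‖ψ‖ := by
  have h := inner_tensor μ f f ψ ψ
  simp only [inner_self_eq_norm_sq_to_K] at h
  have h' : ‖tensor μ f ψ‖ ^ 2 = (‖f‖ * ‖ψ‖) ^ 2 := by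
    rw [mul_pow]
    exact_mod_cast h
  exact (pow_left_inj₀ (norm_nonneg _) (by positivity) two_ne_zero).1 h'

/-- `b*(f) : ψ ↦ f ⊗ ψ` from the `n`- to the `(n+1)`-particle space. -/
def raise (n : ℕ) (f : OneParticle μ) : Sector μ n →L[ℂ] Sector μ (n + 1) :=
  LinearMap.mkContinuous
    { toFun := fun ψ => tensor μ f ψ
      map_add' := by
        intro φ ψ
        apply Lp.ext
        filter_upwards [tensor_coeFn μ f (φ + ψ), tensor_coeFn μ f φ, tensor_coeFn μ f ψ,
          Lp.coeFn_add (tensor μ f φ) (tensor μ f ψ),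
          (quasi_tail μ n).ae (Lp.coeFn_add φ ψ)] with x h1 h2 h3 h4 h5
        rw [h1, h4, h5]
        simp only [Pi.add_apply]
        rw [h2, h3]
        ring
      map_smul' := by
        intro c ψ
        apply Lp.ext
        filter_upwards [tensor_coeFn μ f (c • ψ), tensor_coeFn μ f ψ,
          Lp.coeFn_smul c (tensor μ f ψ),
          (quasi_tail μ n).ae (Lp.coeFn_smul c ψ)] with x h1 h2 h3 h4
        rw [RingHom.id_apply, h1, h3, h4]
        simp only [Pi.smul_apply, smul_eq_mul]
        rw [h2]
        ring }
    ‖f‖ (fun ψ => (norm_tensor μ f ψ).le)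

theorem raise_apply (n : ℕ) (f : OneParticle μ) (ψ : Sector μ n) :
    raise μ n f ψ = tensor μ f ψ := rfl

theorem norm_raise_le (n : ℕ) (f : OneParticle μ) : ‖raise μ n f‖ ≤ ‖f‖ :=
  LinearMap.mkContinuous_norm_le _ (norm_nonneg f) _

/-- `b(f) = b*(f)*` from the `(n+1)`- to the `n`-particle space. It is the unique bounded operator
with `b(f) (g ⊗ ψ) = ⟨f, g⟩ ψ`, see `lower_tensor`. -/
def lower (n : ℕ) (f : OneParticle μ) : Sector μ (n + 1) →L[ℂ] Sector μ n :=
  ContinuousLinearMap.adjoint (raise μ n f)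

theorem lower_tensor (n : ℕ) (f g : OneParticle μ) (ψ : Sector μ n) :
    lower μ n f (tensor μ g ψ) = (inner ℂ f g : ℂ) • ψ := by
  apply ext_inner_left ℂ
  intro χ
  rw [lower, ContinuousLinearMap.adjoint_inner_right, raise_apply, inner_tensor, inner_smul_right]

theorem norm_lower_le (n : ℕ) (f : OneParticle μ) : ‖lower μ n f‖ ≤ ‖f‖ := by
  rw [lower, LinearIsometryEquiv.norm_map]
  exact norm_raise_le μ n f

theorem permOp_tensor {n : ℕ} (σ : Equiv.Perm (Fin n)) (f : OneParticle μ) (ψ : Sector μ n) :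
    permOp μ (Equiv.Perm.decomposeFin.symm (0, σ)) (tensor μ f ψ) = tensor μ f (permOp μ σ ψ) := by
  apply Lp.ext
  filter_upwards [permOp_coeFn μ (Equiv.Perm.decomposeFin.symm (0, σ)) (tensor μ f ψ),
    tensor_coeFn μ f (permOp μ σ ψ),
    (measurePreserving_perm μ (Equiv.Perm.decomposeFin.symm (0, σ))).quasiMeasurePreserving.ae
      (tensor_coeFn μ f ψ),
    (quasi_tail μ n).ae (permOp_coeFn μ σ ψ)] with x h1 h2 h3 h4
  rw [h1, h2, h3, h4]
  simp [Equiv.Perm.decomposeFin_symm_apply_succ, Equiv.Perm.decomposeFin_symm_apply_zero]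

theorem lower_mem_symSector (n : ℕ) (f : OneParticle μ) {ψ : Sector μ (n + 1)}
    (hψ : ψ ∈ SymSector μ (n + 1)) : lower μ n f ψ ∈ SymSector μ n := by
  intro σ
  apply ext_inner_left ℂ
  intro χ
  have h1 : χ = permOp μ σ (permOp μ σ⁻¹ χ) := by
    rw [permOp_permOp, mul_inv_cancel, permOp_one]
  conv_lhs => rw [h1]
  rw [LinearIsometry.inner_map_map, lower, ContinuousLinearMap.adjoint_inner_right,
    ContinuousLinearMap.adjoint_inner_right, raise_apply, raise_apply,
    ← (permOp μ (Equiv.Perm.decomposeFin.symm (0, σ))).inner_map_map, permOp_tensor,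
    permOp_permOp, mul_inv_cancel, permOp_one, hψ]

/-- `b(f)` restricted to bosonic vectors. -/
def lowerSym (n : ℕ) (f : OneParticle μ) : SymSector μ (n + 1) →L[ℂ] SymSector μ n :=
  ((lower μ n f).comp (SymSector μ (n + 1)).subtypeL).codRestrict (SymSector μ n)
    (fun ψ => lower_mem_symSector μ n f ψ.2)

/-- `S_{n+1} b*(f)` restricted to bosonic vectors. -/
def raiseSym (n : ℕ) (f : OneParticle μ) : SymSector μ n →L[ℂ] SymSector μ (n + 1) :=
  (symmetrize μ (n + 1)).comp ((raise μ n f).comp (SymSector μ n).subtypeL)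

theorem norm_lowerSym_apply_le (n : ℕ) (f : OneParticle μ) (ψ : SymSector μ (n + 1)) :
    ‖lowerSym μ n f ψ‖ ≤ ‖f‖ * ‖ψ‖ :=
  (lower μ n f).le_of_opNorm_le (norm_lower_le μ n f) (ψ : Sector μ (n + 1))

theorem norm_symmetrize_apply_le (n : ℕ) (ψ : Sector μ n) : ‖symmetrize μ n ψ‖ ≤ ‖ψ‖ := by
  have h : ‖((n.factorial : ℂ)⁻¹) • ∑ σ : Equiv.Perm (Fin n), permOp μ σ ψ‖ ≤ ‖ψ‖ := by
    have h1 : ‖∑ σ : Equiv.Perm (Fin n), permOp μ σ ψ‖ ≤ (n.factorial : ℝ) * ‖ψ‖ := by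
      refine (norm_sum_le _ _).trans (le_of_eq ?_)
      simp [Fintype.card_perm]
    have h2 : (0 : ℝ) < n.factorial := by exact_mod_cast n.factorial_pos
    rw [norm_smul, norm_inv, Complex.norm_natCast, inv_mul_le_iff₀ h2]
    exact h1
  rw [← coe_symmetrize] at h
  exact h

theorem norm_raiseSym_apply_le (n : ℕ) (f : OneParticle μ) (ψ : SymSector μ n) :
    ‖raiseSym μ n f ψ‖ ≤ ‖f‖ * ‖ψ‖ :=
  (norm_symmetrize_apply_le μ (n + 1) _).trans (norm_tensor μ f (ψ : Sector μ n)).le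

end Sectors

/-! ### The symmetric Fock space and its operators -/

section Fock

variable {X : Type*} [MeasurableSpace X] (μ : Measure X) [SigmaFinite μ]

/-- The symmetric Fock space over `L²(X, μ)`: square summable sequences of bosonic vectors. -/
abbrev Fock : Type _ := lp (fun n : ℕ => SymSector μ n) 2

variable {μ}

/-- The operator `w(𝒩)` for a function `w` of the particle number, with its maximal domain. -/
def numberFun (w : ℕ → ℝ) : Fock μ →ₗ.[ℂ] Fock μ where
  domain :=
    { carrier := {ψ | Memℓp (fun n => (w n : ℂ) • ψ n) 2}
      add_mem' := fun {φ ψ} hφ hψ => by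
        have h := Memℓp.add hφ hψ
        simp only [Set.mem_ofPred_eq, lp.coeFn_add, Pi.add_apply, smul_add]
        exact h
      zero_mem' := by
        have h : Memℓp (0 : (n : ℕ) → SymSector μ n) 2 := zero_memℓp
        simp only [Set.mem_ofPred_eq, lp.coeFn_zero, Pi.zero_apply, smul_zero]
        exact h
      smul_mem' := fun c ψ hψ => by
        have h := Memℓp.const_smul hψ c
        simp only [Set.mem_ofPred_eq, lp.coeFn_smul, Pi.smul_apply, smul_comm _ c]
        exact h }
  toFun :=
    { toFun := fun ψ => ⟨fun n => (w n : ℂ) • (ψ : Fock μ) n, ψ.2⟩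
      map_add' := fun φ ψ => by
        apply lp.ext
        funext n
        exact smul_add (w n : ℂ) ((φ : Fock μ) n) ((ψ : Fock μ) n)
      map_smul' := fun c ψ => by
        apply lp.ext
        funext n
        exact smul_comm (w n : ℂ) c ((ψ : Fock μ) n) }

/-- The number operator `𝒩`. -/
def number : Fock μ →ₗ.[ℂ] Fock μ := numberFun fun n => (n : ℝ)

/-- The square root `𝒩^{1/2}`; its domain is the form domain of `𝒩`. -/
def sqrtNumber : Fock μ →ₗ.[ℂ] Fock μ := numberFun fun n => Real.sqrt n

theorem memlp_two_iff (u : (n : ℕ) → SymSector μ n) :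
    Memℓp u 2 ↔ Summable fun n => ‖u n‖ ^ 2 := by
  rw [memℓp_gen_iff (by norm_num)]
  norm_num

theorem norm_sqrt_smul_sq {n m : ℕ} (v : SymSector μ m) :
    ‖((Real.sqrt n : ℝ) : ℂ) • v‖ ^ 2 = n * ‖v‖ ^ 2 := by
  rw [norm_smul, Complex.norm_real, Real.norm_of_nonneg (Real.sqrt_nonneg _), mul_pow,
    Real.sq_sqrt (Nat.cast_nonneg n)]

theorem summable_of_mem_sqrtNumber {ψ : Fock μ}
    (hψ : ψ ∈ (sqrtNumber (μ := μ)).domain) : Summable fun n : ℕ => (n : ℝ) * ‖ψ n‖ ^ 2 := by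
  have h := (memlp_two_iff _).1 hψ
  simpa only [norm_sqrt_smul_sq] using h

/-- The components `√(n+1) b(f) ψ⁽ⁿ⁺¹⁾` of `a(f) ψ`. -/
def annihilationSeq (f : OneParticle μ) (ψ : Fock μ) (n : ℕ) : SymSector μ n :=
  ((Real.sqrt ((n + 1 : ℕ) : ℝ) : ℝ) : ℂ) • lowerSym μ n f (ψ (n + 1))

/-- The components `√n Sₙ b*(f) ψ⁽ⁿ⁻¹⁾` of `a*(f) ψ`. -/
def creationSeq (f : OneParticle μ) (ψ : Fock μ) : (n : ℕ) → SymSector μ n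
  | 0 => 0
  | n + 1 => ((Real.sqrt ((n + 1 : ℕ) : ℝ) : ℝ) : ℂ) • raiseSym μ n f (ψ n)

theorem memlp_annihilationSeq (f : OneParticle μ) {ψ : Fock μ}
    (hψ : ψ ∈ (sqrtNumber (μ := μ)).domain) : Memℓp (annihilationSeq f ψ) 2 := by
  rw [memlp_two_iff]
  have h := ((summable_nat_add_iff 1).2 (summable_of_mem_sqrtNumber hψ)).mul_left (‖f‖ ^ 2)
  refine Summable.of_nonneg_of_le (fun n => by positivity) (fun n => ?_) h
  rw [annihilationSeq, norm_sqrt_smul_sq]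
  have h1 := pow_le_pow_left₀ (norm_nonneg _) (norm_lowerSym_apply_le μ n f (ψ (n + 1))) 2
  calc ((n + 1 : ℕ) : ℝ) * ‖lowerSym μ n f (ψ (n + 1))‖ ^ 2
      ≤ ((n + 1 : ℕ) : ℝ) * (‖f‖ * ‖ψ (n + 1)‖) ^ 2 := by gcongr
    _ = ‖f‖ ^ 2 * (((n + 1 : ℕ) : ℝ) * ‖ψ (n + 1)‖ ^ 2) := by ring

theorem memlp_creationSeq (f : OneParticle μ) {ψ : Fock μ}
    (hψ : ψ ∈ (sqrtNumber (μ := μ)).domain) : Memℓp (creationSeq f ψ) 2 := by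
  rw [memlp_two_iff, ← summable_nat_add_iff 1]
  have h0 : Summable fun n : ℕ => ‖ψ n‖ ^ 2 := (memlp_two_iff _).1 (lp.memℓp ψ)
  have h := ((summable_of_mem_sqrtNumber hψ).add h0).mul_left (‖f‖ ^ 2)
  refine Summable.of_nonneg_of_le (fun n => by positivity) (fun n => ?_) h
  rw [creationSeq, norm_sqrt_smul_sq]
  have h1 := pow_le_pow_left₀ (norm_nonneg _) (norm_raiseSym_apply_le μ n f (ψ n)) 2
  calc ((n + 1 : ℕ) : ℝ) * ‖raiseSym μ n f (ψ n)‖ ^ 2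
      ≤ ((n + 1 : ℕ) : ℝ) * (‖f‖ * ‖ψ n‖) ^ 2 := by gcongr
    _ = ‖f‖ ^ 2 * ((n : ℝ) * ‖ψ n‖ ^ 2 + ‖ψ n‖ ^ 2) := by push_cast; ring

/-- The annihilation operator `a(f)` on the domain of `𝒩^{1/2}`. -/
def annihilation (f : OneParticle μ) : Fock μ →ₗ.[ℂ] Fock μ where
  domain := (sqrtNumber (μ := μ)).domain
  toFun :=
    { toFun := fun ψ => ⟨annihilationSeq f ψ, memlp_annihilationSeq f ψ.2⟩
      map_add' := fun φ ψ => by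
        apply lp.ext
        funext n
        change annihilationSeq f ((φ : Fock μ) + ψ) n
          = annihilationSeq f (φ : Fock μ) n + annihilationSeq f (ψ : Fock μ) n
        simp only [annihilationSeq, lp.coeFn_add, Pi.add_apply, map_add, smul_add]
      map_smul' := fun c ψ => by
        apply lp.ext
        funext n
        change annihilationSeq f (c • (ψ : Fock μ)) n = c • annihilationSeq f (ψ : Fock μ) n
        simp only [annihilationSeq, lp.coeFn_smul, Pi.smul_apply, map_smul]
        rw [smul_comm] }

/-- The creation operator `a*(f)` on the domain of `𝒩^{1/2}`. -/
def creation (f : OneParticle μ) : Fock μ →ₗ.[ℂ] Fock μ where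
  domain := (sqrtNumber (μ := μ)).domain
  toFun :=
    { toFun := fun ψ => ⟨creationSeq f ψ, memlp_creationSeq f ψ.2⟩
      map_add' := fun φ ψ => by
        apply lp.ext
        funext n
        change creationSeq f ((φ : Fock μ) + ψ) n
          = creationSeq f (φ : Fock μ) n + creationSeq f (ψ : Fock μ) n
        cases n with
        | zero => simp [creationSeq]
        | succ n => simp only [creationSeq, lp.coeFn_add, Pi.add_apply, map_add, smul_add]
      map_smul' := fun c ψ => by
        apply lp.ext
        funext n
        change creationSeq f (c • (ψ : Fock μ)) n = c • creationSeq f (ψ : Fock μ) n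
        cases n with
        | zero => simp [creationSeq]
        | succ n =>
          simp only [creationSeq, lp.coeFn_smul, Pi.smul_apply, map_smul]
          rw [smul_comm] }

/-- The field operator `φ(f) = a(f) + a*(f)` on the domain of `𝒩^{1/2}`. -/
def field (f : OneParticle μ) : Fock μ →ₗ.[ℂ] Fock μ := annihilation f + creation f

end Fock

/-! ### Unbounded operators: unitary groups, expectations, variances -/

section Operators

variable {E : Type*} [NormedAddCommGroup E] [InnerProductSpace ℂ E]

/-- `U t = e^{-itA}`: a strongly continuous one-parameter unitary group whose generator is an
extension of `A`. If `A` is essentially self-adjoint there is exactly one such group. -/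
structure IsUnitaryGroupOf (A : E →ₗ.[ℂ] E) (U : ℝ → E ≃ₗᵢ[ℂ] E) : Prop where
  map_add : ∀ s t : ℝ, ∀ ψ : E, U (s + t) ψ = U s (U t ψ)
  continuous : ∀ ψ : E, Continuous fun t => U t ψ
  hasDerivAt : ∀ ψ : A.domain, HasDerivAt (fun t => U t (ψ : E)) (-Complex.I • A ψ) 0

open Classical in
/-- The unitary operator `e^{-iA}` of an essentially self-adjoint operator `A`
(the identity, by convention, if there is no group as above). -/
def expNegI (A : E →ₗ.[ℂ] E) : E ≃ₗᵢ[ℂ] E :=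
  if h : ∃ U : ℝ → E ≃ₗᵢ[ℂ] E, IsUnitaryGroupOf A U then h.choose 1
  else LinearIsometryEquiv.refl ℂ E

open Classical in
/-- The value `A ψ` (only used for `ψ` in the domain of `A`; `0` by convention otherwise). -/
def value (A : E →ₗ.[ℂ] E) (ψ : E) : E :=
  if h : ψ ∈ A.domain then A ⟨ψ, h⟩ else 0

/-- The expectation `𝔼_ψ[A] = ⟨ψ, A ψ⟩`, a real number for symmetric `A`. -/
def expectation (A : E →ₗ.[ℂ] E) (ψ : E) : ℝ := (inner ℂ ψ (value A ψ) : ℂ).re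

/-- The variance `Var_ψ[A] = ‖A ψ‖² - (𝔼_ψ[A])²`. -/
def variance (A : E →ₗ.[ℂ] E) (ψ : E) : ℝ := ‖value A ψ‖ ^ 2 - expectation A ψ ^ 2

end Operators

/-- The Weyl operator `𝒲(f) = e^{-i φ(i f)}`. -/
def weyl {X : Type*} [MeasurableSpace X] {μ : Measure X} [SigmaFinite μ] (f : OneParticle μ) :
    Fock μ ≃ₗᵢ[ℂ] Fock μ :=
  expNegI (field (Complex.I • f))

/-! ### The box and families of states indexed by the density and the side length -/

/-- Lebesgue measure on the three-dimensional torus `Λ_L = [-L/2, L/2)³`. -/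
abbrev boxMeasure (L : ℝ) : Measure (EuclideanSpace ℝ (Fin 3)) :=
  volume.restrict {x | ∀ i, x i ∈ Set.Ico (-(L / 2)) (L / 2)}

/-- `L²(Λ_L)`. -/
abbrev BoxL2 (L : ℝ) : Type := OneParticle (boxMeasure L)

/-- The symmetric Fock space over `L²(Λ_L)`. -/
abbrev BoxFock (L : ℝ) : Type := Fock (boxMeasure L)

/-- `lim_{ρ → ∞} limsup_{L → ∞} q(ρ, L) = 0`, with upper limits in `[-∞, ∞]`. -/
def IteratedLimitZero (q : ℝ → ℝ → ℝ) : Prop :=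
  Tendsto (fun ρ : ℝ => limsup (fun L : ℝ => (q ρ L : EReal)) atTop) atTop (𝓝 0)

/-- `Ω` is a quasi-vacuum state with respect to the non-zero one-particle functions `f`. -/
structure IsQuasiVacuum (f : (ρ L : ℝ) → BoxL2 L) (Ω : (ρ L : ℝ) → BoxFock L) : Prop where
  ne_zero : ∀ ρ L : ℝ, 0 < ρ → 0 < L → f ρ L ≠ 0
  mem_domain : ∀ ρ L : ℝ, 0 < ρ → 0 < L → Ω ρ L ∈ (number (μ := boxMeasure L)).domain
  norm_eq_one : ∀ ρ L : ℝ, 0 < ρ → 0 < L → ‖Ω ρ L‖ = 1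
  number_small : IteratedLimitZero fun ρ L => ‖value sqrtNumber (Ω ρ L)‖ / ‖f ρ L‖
  variance_close : IteratedLimitZero fun ρ L =>
    |variance (number + field (f ρ L)) (Ω ρ L) / ‖f ρ L‖ ^ 2 - 1|

/-- Quasi-coherent states. -/
structure IsQuasiCoherent (φ : (ρ L : ℝ) → BoxFock L) : Prop where
  mem_domain : ∀ ρ L : ℝ, 0 < ρ → 0 < L → φ ρ L ∈ (number (μ := boxMeasure L)).domain
  norm_eq_one : ∀ ρ L : ℝ, 0 < ρ → 0 < L → ‖φ ρ L‖ = 1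
  expectation_close : IteratedLimitZero fun ρ L =>
    |1 / (ρ * L ^ 3) * expectation number (φ ρ L) - 1|
  variance_close : IteratedLimitZero fun ρ L =>
    |1 / (ρ * L ^ 3) * variance number (φ ρ L) - 1|

/-- `φ` is a quasi-eigenstate of `a(g)` with quasi-eigenvalue `z`. -/
def IsQuasiEigenstate (g : (ρ L : ℝ) → BoxL2 L) (φ : (ρ L : ℝ) → BoxFock L)
    (z : ℝ → ℝ → ℂ) : Prop :=
  IteratedLimitZero fun ρ L =>
    ‖value (annihilation (g ρ L)) (φ ρ L) - z ρ L • φ ρ L‖ / ‖value sqrtNumber (φ ρ L)‖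

/-- Quasi-canonical coherent states. -/
structure IsQuasiCanonicalCoherent (φ : (ρ L : ℝ) → BoxFock L) : Prop
    extends IsQuasiCoherent φ where
  exists_quasiEigenvalue : ∀ g : (ρ L : ℝ) → BoxL2 L,
    (∀ ρ L : ℝ, 0 < ρ → 0 < L → ‖g ρ L‖ = 1) →
      ∃ z : ℝ → ℝ → ℂ, IsQuasiEigenstate g φ z

end BoseFock

end

noncomputable section

namespace BoseFock


/-! ### Exponential series of vectors -/

section ExpSeries

variable {F : Type*} [NormedAddCommGroup F] [NormedSpace ℝ F]

/-- `∑ rⁿ ‖cₙ‖ / n!` converges for all `r`. -/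
def ExpSummable (c : ℕ → F) : Prop := ∀ r : ℝ, Summable fun n => r ^ n / n.factorial * ‖c n‖

/-- `∑ tⁿ cₙ / n!`. -/
def expSeries (c : ℕ → F) (t : ℝ) : F := ∑' n, (t ^ n / n.factorial : ℝ) • c n

theorem norm_exp_term (c : ℕ → F) (t : ℝ) (n : ℕ) :
    ‖(t ^ n / n.factorial : ℝ) • c n‖ = |t| ^ n / n.factorial * ‖c n‖ := by
  rw [norm_smul, norm_div, norm_pow, Real.norm_eq_abs, Real.norm_natCast]

theorem expSeries_zero (c : ℕ → F) : expSeries c 0 = c 0 := by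
  rw [expSeries, tsum_eq_single 0 (fun n hn => by simp [hn])]
  simp

theorem sum_antidiagonal_exp_term (s t : ℝ) (n : ℕ) :
    ∑ p ∈ Finset.HasAntidiagonal.antidiagonal n, (s ^ p.1 / p.1.factorial * (t ^ p.2 / p.2.factorial)) =
      (s + t) ^ n / n.factorial := by
  rw [(Commute.all s t).add_pow', Finset.sum_div]
  refine Finset.sum_congr rfl fun p hp => ?_
  rw [Finset.HasAntidiagonal.mem_antidiagonal] at hp
  subst hp
  rw [nsmul_eq_mul, Nat.cast_add_choose ℝ]
  field_simp

/-- The terms of the product of two exponential series. -/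
def expTerm (c : ℕ → F) (s t : ℝ) (p : ℕ × ℕ) : F :=
  (s ^ p.1 / p.1.factorial * (t ^ p.2 / p.2.factorial) : ℝ) • c (p.1 + p.2)

variable [CompleteSpace F]

theorem ExpSummable.summable {c : ℕ → F} (hc : ExpSummable c) (t : ℝ) :
    Summable fun n => (t ^ n / n.factorial : ℝ) • c n := by
  apply Summable.of_norm
  simp only [norm_exp_term]
  exact hc |t|

theorem ExpSummable.summable_expTerm {c : ℕ → F} (hc : ExpSummable c) (s t : ℝ) :
    Summable (expTerm c s t) := by
  apply Summable.of_norm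
  rw [← Finset.HasAntidiagonal.sigmaAntidiagonalEquivProd.summable_iff]
  refine (summable_sigma_of_nonneg fun _ => norm_nonneg _).2 ⟨fun n => Summable.of_finite, ?_⟩
  refine (hc (|s| + |t|)).congr fun n => ?_
  rw [tsum_fintype, ← sum_antidiagonal_exp_term, Finset.sum_mul]
  refine Eq.trans ?_
    (Finset.sum_coe_sort (Finset.HasAntidiagonal.antidiagonal n) fun p => ‖expTerm c s t p‖).symm
  refine Finset.sum_congr rfl fun p hp => ?_
  rw [Finset.HasAntidiagonal.mem_antidiagonal] at hp
  rw [expTerm, norm_smul, hp]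
  simp

theorem ExpSummable.tsum_expSeries {c : ℕ → F} (hc : ExpSummable c) (s t : ℝ) :
    ∑' n, (s ^ n / n.factorial : ℝ) • expSeries (fun m => c (n + m)) t = expSeries c (s + t) := by
  have h := hc.summable_expTerm s t
  have h1 : ∑' p : ℕ × ℕ, expTerm c s t p =
      ∑' n, (s ^ n / n.factorial : ℝ) • expSeries (fun m => c (n + m)) t := by
    rw [h.tsum_prod]
    refine tsum_congr fun n => ?_
    rw [expSeries, ← tsum_const_smul'']
    simp only [expTerm, mul_smul]
  rw [← h1, ← Finset.HasAntidiagonal.sigmaAntidiagonalEquivProd.tsum_eq]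
  refine (Summable.tsum_sigma
    (Finset.HasAntidiagonal.sigmaAntidiagonalEquivProd.summable_iff.2 h)).trans ?_
  rw [expSeries]
  refine tsum_congr fun n => ?_
  rw [tsum_fintype, ← sum_antidiagonal_exp_term, Finset.sum_smul]
  refine (Finset.sum_coe_sort (Finset.HasAntidiagonal.antidiagonal n) (expTerm c s t)).trans ?_
  refine Finset.sum_congr rfl fun p hp => ?_
  rw [Finset.HasAntidiagonal.mem_antidiagonal] at hp
  rw [expTerm, hp]

theorem ExpSummable.hasDerivAt_zero {c : ℕ → F} (hc : ExpSummable c) :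
    HasDerivAt (expSeries c) (c 1) 0 := by
  rw [hasDerivAt_iff_isLittleO]
  have hs := (summable_nat_add_iff 2).2 (hc 1)
  simp only [one_pow] at hs
  have hO : (fun t : ℝ => expSeries c t - expSeries c 0 - (t - 0) • c 1) =O[𝓝 0]
      fun t : ℝ => t ^ 2 := by
    apply Asymptotics.IsBigO.of_bound
      (∑' n : ℕ, 1 / ((n + 2).factorial : ℝ) * ‖c (n + 2)‖)
    filter_upwards [Metric.ball_mem_nhds (0 : ℝ) one_pos] with t ht
    have ht1 : |t| ≤ 1 := by
      rw [Metric.mem_ball, dist_zero_right, Real.norm_eq_abs] at ht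
      exact ht.le
    have h2 : expSeries c t - expSeries c 0 - (t - 0) • c 1 =
        ∑' n : ℕ, (t ^ (n + 2) / (n + 2).factorial : ℝ) • c (n + 2) := by
      rw [expSeries_zero, expSeries, ← (hc.summable t).sum_add_tsum_nat_add 2]
      simp only [Finset.sum_range_succ, Finset.sum_range_zero, zero_add, pow_zero, pow_one,
        Nat.factorial_zero, Nat.factorial_one, Nat.cast_one, div_one, one_smul, sub_zero]
      abel
    rw [h2, mul_comm, ← tsum_mul_left]
    refine tsum_of_norm_bounded (hs.mul_left _).hasSum fun n => ?_
    rw [norm_exp_term c t (n + 2), norm_pow, Real.norm_eq_abs, pow_add]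
    have : |t| ^ n ≤ 1 := pow_le_one₀ (abs_nonneg t) ht1
    calc |t| ^ n * |t| ^ 2 / ((n + 2).factorial : ℝ) * ‖c (n + 2)‖
        ≤ 1 * |t| ^ 2 / ((n + 2).factorial : ℝ) * ‖c (n + 2)‖ := by gcongr
      _ = _ := by ring
  refine hO.trans_isLittleO ?_
  simpa using Asymptotics.isLittleO_pow_id (𝕜 := ℝ) (n := 2) (by norm_num)

end ExpSeries

/-! ### Unitary groups generated by skew-symmetric operators with a dense set of analytic vectors -/

section AnalyticVectors

variable {E : Type*} [NormedAddCommGroup E] [InnerProductSpace ℂ E] [CompleteSpace E]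
  {V : Type*} [AddCommGroup V] [Module ℂ V] {j : V →ₗ[ℂ] E} {B : Module.End ℂ V}

theorem expSeries_add (hsum : ∀ x, ExpSummable fun n => j ((B ^ n) x)) (t : ℝ) (x y : V) :
    expSeries (fun n => j ((B ^ n) (x + y))) t =
      expSeries (fun n => j ((B ^ n) x)) t + expSeries (fun n => j ((B ^ n) y)) t := by
  rw [expSeries, expSeries, expSeries, ← ((hsum x).summable t).tsum_add ((hsum y).summable t)]
  simp only [map_add, smul_add]

omit [CompleteSpace E] in
theorem expSeries_smul (t : ℝ) (c : ℂ) (x : V) :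
    expSeries (fun n => j ((B ^ n) (c • x))) t = c • expSeries (fun n => j ((B ^ n) x)) t := by
  rw [expSeries, expSeries, ← tsum_const_smul'']
  refine tsum_congr fun n => ?_
  rw [map_smul, map_smul, smul_comm]

/-- The exponential series `x ↦ ∑ tⁿ Bⁿ x / n!` on analytic vectors. -/
def expMap (j : V →ₗ[ℂ] E) (B : Module.End ℂ V)
    (hsum : ∀ x, ExpSummable fun n => j ((B ^ n) x)) (t : ℝ) : V →ₗ[ℂ] E where
  toFun x := expSeries (fun n => j ((B ^ n) x)) t
  map_add' := expSeries_add hsum t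
  map_smul' := expSeries_smul t

omit [CompleteSpace E] in
theorem inner_pow_of_skew (hskew : ∀ x y, inner ℂ (j (B x)) (j y) = -inner ℂ (j x) (j (B y)))
    (n : ℕ) (x y : V) :
    (inner ℂ (j ((B ^ n) x)) (j y) : ℂ) = (-1) ^ n * inner ℂ (j x) (j ((B ^ n) y)) := by
  induction n generalizing x y with
  | zero => simp
  | succ n ih =>
    rw [pow_succ', Module.End.mul_apply, hskew, ih, ← Module.End.mul_apply (B ^ n) B,
      ← pow_succ, pow_succ', Module.End.mul_apply, pow_succ]
    ring

theorem inner_expMap (hskew : ∀ x y, inner ℂ (j (B x)) (j y) = -inner ℂ (j x) (j (B y)))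
    (hsum : ∀ x, ExpSummable fun n => j ((B ^ n) x)) (t : ℝ) (x y : V) :
    (inner ℂ (expMap j B hsum t x) (expMap j B hsum t y) : ℂ) = inner ℂ (j x) (j y) := by
  have hc : ExpSummable fun n => (inner ℂ (j x) (j ((B ^ n) y)) : ℂ) := by
    intro r
    refine Summable.of_norm_bounded ((hsum y |r|).mul_left ‖j x‖) fun n => ?_
    rw [norm_mul, norm_norm, norm_div, norm_pow, Real.norm_eq_abs, Real.norm_natCast]
    calc _ ≤ |r| ^ n / (n.factorial : ℝ) * (‖j x‖ * ‖j ((B ^ n) y)‖) := by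
          gcongr
          exact norm_inner_le_norm _ _
      _ = _ := by ring
  have h := hc.tsum_expSeries (-t) t
  rw [neg_add_cancel, expSeries_zero] at h
  simp only [pow_zero, Module.End.one_apply] at h
  rw [← h]
  have hr : ∀ z : E, (inner ℂ z (expMap j B hsum t y) : ℂ) =
      expSeries (fun n => (inner ℂ z (j ((B ^ n) y)) : ℂ)) t := fun z => by
    change (innerSL ℂ z) (∑' n, _) = ∑' n, _
    rw [(innerSL ℂ z).map_tsum ((hsum y).summable t)]
    refine tsum_congr fun n => ?_
    rw [innerSL_apply_apply, ← Complex.coe_smul, inner_smul_right, Complex.real_smul]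
  have hl : ∀ z : E, (inner ℂ (expMap j B hsum t x) z : ℂ) =
      ∑' n, (t ^ n / n.factorial : ℝ) • (inner ℂ (j ((B ^ n) x)) z : ℂ) := fun z => by
    have h1 := ((hsum x).summable t).hasSum.mapL (innerSLFlip ℂ z)
    rw [← innerSLFlip_apply_apply]
    change (innerSLFlip ℂ z) (∑' n, _) = _
    rw [← h1.tsum_eq]
    refine tsum_congr fun n => ?_
    rw [innerSLFlip_apply_apply, ← Complex.coe_smul, inner_smul_left, Complex.conj_ofReal]
    simp
  rw [hl]
  refine tsum_congr fun n => ?_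
  rw [hr]
  have h2 : ∀ m, (inner ℂ (j ((B ^ n) x)) (j ((B ^ m) y)) : ℂ)
      = (-1 : ℝ) ^ n • (inner ℂ (j x) (j ((B ^ (n + m)) y)) : ℂ) := fun m => by
    rw [inner_pow_of_skew hskew, pow_add, Module.End.mul_apply]
    simp
  simp only [h2, expSeries]
  simp only [smul_comm _ ((-1 : ℝ) ^ n)]
  rw [tsum_const_smul'', smul_smul, neg_pow t]
  congr 1
  ring

theorem norm_expMap (hskew : ∀ x y, inner ℂ (j (B x)) (j y) = -inner ℂ (j x) (j (B y)))
    (hsum : ∀ x, ExpSummable fun n => j ((B ^ n) x)) (t : ℝ) (x : V) :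
    ‖expMap j B hsum t x‖ = ‖j x‖ := by
  rw [@norm_eq_sqrt_re_inner ℂ, @norm_eq_sqrt_re_inner ℂ _ _ _ _ (j x),
    inner_expMap hskew hsum]

/-- The continuous extension of the exponential series to the whole space. -/
def expExtend (j : V →ₗ[ℂ] E) (B : Module.End ℂ V)
    (hsum : ∀ x, ExpSummable fun n => j ((B ^ n) x)) (t : ℝ) : E →L[ℂ] E :=
  (expMap j B hsum t).extendOfNorm j

variable (hj : DenseRange j)
  (hskew : ∀ x y, inner ℂ (j (B x)) (j y) = -inner ℂ (j x) (j (B y)))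
  (hsum : ∀ x, ExpSummable fun n => j ((B ^ n) x))

include hj hskew hsum

theorem expExtend_apply (t : ℝ) (x : V) :
    expExtend j B hsum t (j x) = expSeries (fun n => j ((B ^ n) x)) t :=
  LinearMap.extendOfNorm_eq hj ⟨1, fun x => by rw [norm_expMap hskew hsum, one_mul]⟩ x

theorem norm_expExtend (t : ℝ) (ψ : E) : ‖expExtend j B hsum t ψ‖ = ‖ψ‖ :=
  isClosed_property hj (isClosed_eq (expExtend j B hsum t).continuous.norm continuous_norm) (fun x => by
    rw [expExtend_apply hj hskew hsum]
    exact norm_expMap hskew hsum t x) ψ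

theorem expExtend_add (s t : ℝ) (ψ : E) :
    expExtend j B hsum (s + t) ψ = expExtend j B hsum s (expExtend j B hsum t ψ) :=
  isClosed_property hj (isClosed_eq (expExtend j B hsum (s + t)).continuous
    ((expExtend j B hsum s).continuous.comp (expExtend j B hsum t).continuous)) (fun x => by
    rw [Function.comp_apply, expExtend_apply hj hskew hsum, expExtend_apply hj hskew hsum, add_comm,
      ← (hsum x).tsum_expSeries t s, expSeries,
      (expExtend j B hsum s).map_tsum ((hsum x).summable t)]
    refine tsum_congr fun n => ?_
    rw [← Complex.coe_smul, ← Complex.coe_smul, map_smul,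
      expExtend_apply hj hskew hsum]
    congr 2
    funext m
    rw [add_comm n m, pow_add, Module.End.mul_apply]) ψ

theorem expExtend_zero (ψ : E) : expExtend j B hsum 0 ψ = ψ :=
  isClosed_property hj (isClosed_eq (expExtend j B hsum 0).continuous continuous_id) (fun x => by
    rw [expExtend_apply hj hskew hsum, expSeries_zero]
    rfl) ψ

/-- The unitary group generated by `B`. -/
def expUnitary (t : ℝ) : E ≃ₗᵢ[ℂ] E where
  toLinearMap := (expExtend j B hsum t : E →ₗ[ℂ] E)
  invFun := expExtend j B hsum (-t)
  left_inv ψ := by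
    change expExtend j B hsum (-t) (expExtend j B hsum t ψ) = ψ
    rw [← expExtend_add hj hskew, neg_add_cancel, expExtend_zero hj hskew]
  right_inv ψ := by
    change expExtend j B hsum t (expExtend j B hsum (-t) ψ) = ψ
    rw [← expExtend_add hj hskew, add_neg_cancel, expExtend_zero hj hskew]
  norm_map' := norm_expExtend hj hskew hsum t

theorem expUnitary_apply (t : ℝ) (x : V) :
    expUnitary hj hskew hsum t (j x) = expSeries (fun n => j ((B ^ n) x)) t :=
  expExtend_apply hj hskew hsum t x

theorem expUnitary_add (s t : ℝ) (ψ : E) : expUnitary hj hskew hsum (s + t) ψ =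
    expUnitary hj hskew hsum s (expUnitary hj hskew hsum t ψ) :=
  expExtend_add hj hskew hsum s t ψ

theorem hasDerivAt_expUnitary_apply (t : ℝ) (x : V) :
    HasDerivAt (fun s => expUnitary hj hskew hsum s (j x))
      (expUnitary hj hskew hsum t (j (B x))) t := by
  have h : HasDerivAt (fun s => expUnitary hj hskew hsum s (j x)) (j (B x)) 0 := by
    simp only [expUnitary_apply]
    exact (hsum x).hasDerivAt_zero
  have h' : HasDerivAt (fun s => expUnitary hj hskew hsum s (j x)) (j (B x)) (t + -t) := by
    rwa [add_neg_cancel]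
  have h2 := ((expUnitary hj hskew hsum t).toContinuousLinearEquiv.toContinuousLinearMap.restrictScalars
    ℝ).hasFDerivAt.comp_hasDerivAt t (h'.comp_add_const t (-t))
  refine h2.congr_of_eventuallyEq (Eventually.of_forall fun s => ?_)
  change _ = expUnitary hj hskew hsum t (expUnitary hj hskew hsum (s + -t) (j x))
  rw [← expUnitary_add]
  congr 2
  ring

theorem continuous_expUnitary (ψ : E) : Continuous fun t => expUnitary hj hskew hsum t ψ := by
  refine continuous_of_uniform_approx_of_continuous fun u hu => ?_
  obtain ⟨ε, hε, hεu⟩ := Metric.mem_uniformity_dist.1 hu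
  obtain ⟨x, hx⟩ := hj.exists_dist_lt ψ hε
  refine ⟨fun t => expUnitary hj hskew hsum t (j x), ?_, fun t => hεu ?_⟩
  · exact continuous_iff_continuousAt.2 fun t =>
      (hasDerivAt_expUnitary_apply hj hskew hsum t x).continuousAt
  · rwa [LinearIsometryEquiv.dist_map]

theorem hasDerivAt_expUnitary {x : ℕ → V} {ψ η : E} (hx : Tendsto (fun n => j (x n)) atTop (𝓝 ψ))
    (hBx : Tendsto (fun n => j (B (x n))) atTop (𝓝 η)) :
    HasDerivAt (fun t => expUnitary hj hskew hsum t ψ) η 0 := by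
  have h := hasDerivAt_of_tendstoUniformly (l := atTop)
    (f := fun n t => expUnitary hj hskew hsum t (j (x n)))
    (f' := fun n t => expUnitary hj hskew hsum t (j (B (x n))))
    (g := fun t => expUnitary hj hskew hsum t ψ)
    (g' := fun t => expUnitary hj hskew hsum t η) ?_ ?_ ?_ 0
  · have h0 : expUnitary hj hskew hsum 0 η = η := expExtend_zero hj hskew hsum η
    rwa [h0] at h
  · rw [Metric.tendstoUniformly_iff]
    intro ε hε
    filter_upwards [(Metric.tendsto_nhds.1 hBx) ε hε] with n hn t
    rwa [LinearIsometryEquiv.dist_map, dist_comm]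
  · exact Eventually.of_forall fun n t => hasDerivAt_expUnitary_apply hj hskew hsum t (x n)
  · exact fun t => ((expUnitary hj hskew hsum t).continuous.tendsto ψ).comp hx

/-- An operator `-iA` that is a closure of a skew-symmetric operator with analytic vectors generates
a unitary group. -/
theorem exists_isUnitaryGroupOf {A : E →ₗ.[ℂ] E} (hA : ∀ ψ : A.domain, ∃ x : ℕ → V,
    Tendsto (fun n => j (x n)) atTop (𝓝 (ψ : E)) ∧
      Tendsto (fun n => j (B (x n))) atTop (𝓝 (-Complex.I • A ψ))) :
    ∃ U : ℝ → E ≃ₗᵢ[ℂ] E, IsUnitaryGroupOf A U :=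
  ⟨expUnitary hj hskew hsum, expUnitary_add hj hskew hsum, continuous_expUnitary hj hskew hsum,
    fun ψ => by
      obtain ⟨x, h1, h2⟩ := hA ψ
      exact hasDerivAt_expUnitary hj hskew hsum h1 h2⟩

end AnalyticVectors

section Uniqueness

variable {E : Type*} [NormedAddCommGroup E] [InnerProductSpace ℂ E]
  {V : Type*} [AddCommGroup V] [Module ℂ V] {j : V →ₗ[ℂ] E} {B : Module.End ℂ V}

theorem IsUnitaryGroupOf.zero {A : E →ₗ.[ℂ] E} {U : ℝ → E ≃ₗᵢ[ℂ] E} (hU : IsUnitaryGroupOf A U)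
    (ψ : E) : U 0 ψ = ψ := by
  have h := hU.map_add 0 0 ψ
  rw [add_zero] at h
  exact ((U 0).injective h).symm

theorem IsUnitaryGroupOf.hasDerivAt_apply {A : E →ₗ.[ℂ] E} {U : ℝ → E ≃ₗᵢ[ℂ] E}
    (hU : IsUnitaryGroupOf A U) (ψ : A.domain) (t : ℝ) :
    HasDerivAt (fun s => U s (ψ : E)) (U t (-Complex.I • A ψ)) t := by
  have h' : HasDerivAt (fun s => U s (ψ : E)) (-Complex.I • A ψ) (t + -t) := by
    rw [add_neg_cancel]
    exact hU.hasDerivAt ψ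
  have h2 := ((U t).toContinuousLinearEquiv.toContinuousLinearMap.restrictScalars
    ℝ).hasFDerivAt.comp_hasDerivAt t (h'.comp_add_const t (-t))
  refine h2.congr_of_eventuallyEq (Eventually.of_forall fun s => ?_)
  change _ = U t (U (s + -t) (ψ : E))
  rw [← hU.map_add]
  congr 2
  ring

/-- Every unitary group generated by an extension of `A` is given by the exponential series on
analytic vectors. -/
theorem IsUnitaryGroupOf.tendsto_sum {A : E →ₗ.[ℂ] E} {U : ℝ → E ≃ₗᵢ[ℂ] E}
    (hU : IsUnitaryGroupOf A U)
    (hB : ∀ x, ∃ h : j x ∈ A.domain, -Complex.I • A ⟨j x, h⟩ = j (B x))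
    (hsum : ∀ x, ExpSummable fun n => j ((B ^ n) x)) (x : V) :
    Tendsto (fun K => j (∑ n ∈ Finset.range K, ((n.factorial : ℂ)⁻¹) • (B ^ n) x)) atTop
      (𝓝 (U 1 (j x))) := by
  have hd : ∀ (y : V) (t : ℝ), HasDerivAt (fun s => U (-s) (j y)) (-U (-t) (j (B y))) t := by
    intro y t
    obtain ⟨hy, hy'⟩ := hB y
    have h := hU.hasDerivAt_apply ⟨j y, hy⟩ (-t)
    rw [hy'] at h
    simpa [Function.comp_def] using h.scomp t (hasDerivAt_neg t)
  have hder : ∀ (K : ℕ) (t : ℝ), HasDerivAt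
      (fun s => ∑ n ∈ Finset.range (K + 1), (s ^ n / n.factorial : ℝ) • U (-s) (j ((B ^ n) x)))
      (-((t ^ K / K.factorial : ℝ) • U (-t) (j ((B ^ (K + 1)) x)))) t := by
    intro K t
    induction K with
    | zero =>
      have h := hd x t
      simpa using h
    | succ K ih =>
      have h1 : HasDerivAt (fun s : ℝ => s ^ (K + 1) / ((K + 1).factorial : ℝ))
          (t ^ K / K.factorial) t := by
        refine ((hasDerivAt_pow (K + 1) t).div_const ((K + 1).factorial : ℝ)).congr_deriv ?_
        rw [Nat.factorial_succ]
        have : (K.factorial : ℝ) ≠ 0 := by positivity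
        push_cast
        field_simp
      have h2 := ih.add (h1.smul (hd ((B ^ (K + 1)) x) t))
      simp_rw [Finset.sum_range_succ _ (K + 1)]
      refine h2.congr_deriv ?_
      rw [pow_succ' B (K + 1), Module.End.mul_apply, smul_neg]
      abel
  have hbound : ∀ K : ℕ, ‖j (∑ n ∈ Finset.range (K + 1), ((n.factorial : ℂ)⁻¹) • (B ^ n) x)
      - U 1 (j x)‖ ≤ 1 / K.factorial * ‖j ((B ^ (K + 1)) x)‖ := by
    intro K
    have h := norm_image_sub_le_of_norm_deriv_le_segment_01'
      (f := fun s => ∑ n ∈ Finset.range (K + 1), (s ^ n / n.factorial : ℝ) • U (-s) (j ((B ^ n) x)))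
      (C := 1 / K.factorial * ‖j ((B ^ (K + 1)) x)‖)
      (fun t _ => (hder K t).hasDerivWithinAt) (fun t ht => by
        rw [norm_neg, norm_exp_term (fun _ => U (-t) (j ((B ^ (K + 1)) x))) t K,
          LinearIsometryEquiv.norm_map]
        gcongr
        exact pow_le_one₀ (abs_nonneg t) (abs_le.2 ⟨by linarith [ht.1], ht.2.le⟩))
    refine le_trans (le_of_eq ?_) h
    rw [← (U 1).norm_map (_ - _)]
    rw [← (U (-1)).norm_map]
    have e : ∀ z, U (-1) (U 1 z) = z := fun z => by
      rw [← hU.map_add, neg_add_cancel, hU.zero]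
    rw [e]
    have e0 : ∑ n ∈ Finset.range (K + 1), ((0 : ℝ) ^ n / n.factorial : ℝ) • U (-0) (j ((B ^ n) x))
        = j x := by
      rw [Finset.sum_eq_single 0 (fun n _ hn => by simp [hn]) (by simp)]
      simp [hU.zero]
    have e1 : ∑ n ∈ Finset.range (K + 1), ((1 : ℝ) ^ n / n.factorial : ℝ) • U (-1) (j ((B ^ n) x))
        = U (-1) (j (∑ n ∈ Finset.range (K + 1), ((n.factorial : ℂ)⁻¹) • (B ^ n) x)) := by
      rw [map_sum, map_sum]
      refine Finset.sum_congr rfl fun n _ => ?_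
      rw [map_smul, map_smul, ← Complex.coe_smul]
      simp
    rw [e0, e1]
    nth_rewrite 2 [← e (j x)]
    rw [← map_sub, (U (-1)).norm_map]
  rw [← tendsto_add_atTop_iff_nat 1, tendsto_iff_norm_sub_tendsto_zero]
  refine squeeze_zero (fun _ => norm_nonneg _) hbound ?_
  refine squeeze_zero (fun _ => by positivity) (fun K => ?_)
    (((summable_nat_add_iff 1).2 (hsum x 2)).tendsto_atTop_zero)
  gcongr ?_ * _
  rw [div_le_div_iff₀ (by positivity) (by positivity), Nat.factorial_succ, one_mul]
  push_cast
  gcongr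
  exact_mod_cast (Nat.lt_two_pow_self (n := K + 1)).le

end Uniqueness


/-! ### Canonical commutation relations on the sectors -/

section SectorCCR

variable {X : Type*} [MeasurableSpace X] (μ : Measure X) [SigmaFinite μ]

theorem measurePreserving_finCons (n : ℕ) :
    MeasurePreserving (fun p : X × (Fin n → X) => (Fin.cons p.1 p.2 : Fin (n + 1) → X))
      (μ.prod (Measure.pi (fun _ : Fin n => μ))) (Measure.pi (fun _ : Fin (n + 1) => μ)) := by
  have h := (measurePreserving_piFinSuccAbove (fun _ : Fin (n + 1) => μ) 0).symm
  convert h using 1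
  funext p
  simp [MeasurableEquiv.piFinSuccAbove]
  rfl

/-- `(b(f) ψ)(x₁, …, xₙ) = ∫ conj (f y) ψ(y, x₁, …, xₙ) dy`. -/
theorem lower_coeFn (n : ℕ) (f : OneParticle μ) (ψ : Sector μ (n + 1)) :
    lower μ n f ψ =ᵐ[Measure.pi (fun _ : Fin n => μ)]
      fun x => ∫ y, (starRingEnd ℂ) (f y) * ψ (Fin.cons y x) ∂μ := by
  have key : ∀ s : Set (Fin n → X), MeasurableSet s →
      Measure.pi (fun _ : Fin n => μ) s < ⊤ →
      IntegrableOn (fun x => ∫ y, (starRingEnd ℂ) (f y) * ψ (Fin.cons y x) ∂μ) s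
        (Measure.pi (fun _ : Fin n => μ)) ∧
      ∫ x in s, lower μ n f ψ x ∂(Measure.pi (fun _ : Fin n => μ)) =
        ∫ x in s, ∫ y, (starRingEnd ℂ) (f y) * ψ (Fin.cons y x) ∂μ
          ∂(Measure.pi (fun _ : Fin n => μ)) := by
    intro s hs hμs
    set χ : Sector μ n := indicatorConstLp 2 hs hμs.ne (1 : ℂ) with hχ
    have hcons := measurePreserving_finCons μ n
    have h1 : (fun p : X × (Fin n → X) =>
        (inner ℂ (tensor μ f χ (Fin.cons p.1 p.2)) (ψ (Fin.cons p.1 p.2)) : ℂ))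
        =ᵐ[μ.prod (Measure.pi (fun _ : Fin n => μ))] fun p =>
          s.indicator 1 p.2 * ((starRingEnd ℂ) (f p.1) * ψ (Fin.cons p.1 p.2)) := by
      have hi : (χ : (Fin n → X) → ℂ) =ᵐ[_] s.indicator fun _ => 1 := indicatorConstLp_coeFn
      filter_upwards [hcons.quasiMeasurePreserving.ae (tensor_coeFn μ f χ),
        Measure.quasiMeasurePreserving_snd.ae hi] with p h1 h2
      rw [h1]
      simp only [Fin.cons_zero, Fin.cons_succ]
      rw [h2, RCLike.inner_apply, map_mul]
      by_cases hp : p.2 ∈ s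
      · simp [hp]; ring
      · simp [hp]
    have hint : Integrable (fun p : X × (Fin n → X) =>
        (inner ℂ (tensor μ f χ (Fin.cons p.1 p.2)) (ψ (Fin.cons p.1 p.2)) : ℂ))
        (μ.prod (Measure.pi (fun _ : Fin n => μ))) :=
      hcons.integrable_comp_of_integrable (L2.integrable_inner (𝕜 := ℂ) (tensor μ f χ) ψ)
    have hint' := hint.congr h1
    have hin : ∀ x, ∫ y, s.indicator 1 x * ((starRingEnd ℂ) (f y) * ψ (Fin.cons y x)) ∂μ =
        s.indicator (fun x => ∫ y, (starRingEnd ℂ) (f y) * ψ (Fin.cons y x) ∂μ) x := by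
      intro x
      rw [integral_const_mul]
      by_cases hx : x ∈ s <;> simp [hx]
    constructor
    · rw [← integrable_indicator_iff hs]
      refine hint'.integral_prod_right.congr (Eventually.of_forall hin)
    · have hmap := integral_map hcons.measurable.aemeasurable
        (f := fun x => (inner ℂ (tensor μ f χ x) (ψ x) : ℂ)) (by
          rw [hcons.map_eq]
          exact (L2.integrable_inner (𝕜 := ℂ) (tensor μ f χ) ψ).1)
      rw [hcons.map_eq] at hmap
      rw [← integral_indicator hs (f := fun x => ∫ y, (starRingEnd ℂ) (f y) * ψ (Fin.cons y x) ∂μ),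
        ← L2.inner_indicatorConstLp_one (𝕜 := ℂ) hs hμs.ne, ← hχ, lower,
        ContinuousLinearMap.adjoint_inner_right, raise_apply, L2.inner_def, hmap,
        integral_congr_ae h1, integral_prod_symm _ hint']
      exact integral_congr_ae (Eventually.of_forall hin)
  refine ae_eq_of_forall_setIntegral_eq_of_sigmaFinite (fun s hs hμs => ?_)
    (fun s hs hμs => (key s hs hμs).1) (fun s hs hμs => (key s hs hμs).2)
  have : IsFiniteMeasure ((Measure.pi (fun _ : Fin n => μ)).restrict s) :=
    ⟨by rwa [Measure.restrict_apply_univ]⟩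
  exact ((Lp.memLp (lower μ n f ψ)).restrict s).integrable (by norm_num)

/-- `b(f)` applied to `g ⊗ ψ` with the first two variables exchanged is `g ⊗ b(f) ψ`. -/
theorem lower_swap_tensor (n : ℕ) (f g : OneParticle μ) (ψ : Sector μ (n + 1)) :
    lower μ (n + 1) f (permOp μ (Equiv.swap 0 1) (tensor μ g ψ)) =
      tensor μ g (lower μ n f ψ) := by
  apply Lp.ext
  have h1 := lower_coeFn μ (n + 1) f (permOp μ (Equiv.swap 0 1) (tensor μ g ψ))
  have h2 := (quasi_tail μ n).ae (lower_coeFn μ n f ψ)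
  have h3 : ∀ᵐ x ∂(Measure.pi (fun _ : Fin (n + 2) => μ)),
      permOp μ (Equiv.swap 0 1) (tensor μ g ψ) x =
        g (x 1) * ψ (fun i => x ((Equiv.swap 0 1) i.succ)) := by
    filter_upwards [permOp_coeFn μ (Equiv.swap 0 1) (tensor μ g ψ),
      (measurePreserving_perm μ (Equiv.swap 0 1)).quasiMeasurePreserving.ae
        (tensor_coeFn μ g ψ)] with x h1 h2
    rw [h1, h2, Equiv.swap_apply_left]
  have h4 := (measurePreserving_finCons μ (n + 1)).quasiMeasurePreserving.ae h3
  have h5 := Measure.ae_ae_of_ae_prod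
    ((Measure.measurePreserving_swap (μ := Measure.pi (fun _ : Fin (n + 1) => μ))
      (ν := μ)).quasiMeasurePreserving.ae h4)
  filter_upwards [h1, h2, tensor_coeFn μ g (lower μ n f ψ), h5] with x h1 h2 h3 h5
  rw [h1, h3, h2, ← integral_const_mul]
  refine integral_congr_ae ?_
  filter_upwards [h5] with y hy
  simp only [Prod.swap_prod_mk] at hy
  rw [hy]
  have e1 : (Fin.cons y x : Fin (n + 2) → X) 1 = x 0 := rfl
  have e2 : (fun i : Fin (n + 1) => (Fin.cons y x : Fin (n + 2) → X) ((Equiv.swap 0 1) i.succ))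
      = Fin.cons y fun i : Fin n => x i.succ := by
    funext i
    refine Fin.cases ?_ (fun i => ?_) i
    · have : (Fin.succ 0 : Fin (n + 2)) = 1 := rfl
      rw [this, Equiv.swap_apply_right]
      rfl
    · have : Equiv.swap (0 : Fin (n + 2)) 1 i.succ.succ = i.succ.succ :=
        Equiv.swap_apply_of_ne_of_ne (Fin.succ_ne_zero _)
          (fun h => Fin.succ_ne_zero i (Fin.succ_injective _ h))
      rw [this]
      rfl
  rw [e1, e2]
  ring

theorem inner_permOp_left {n : ℕ} (σ : Equiv.Perm (Fin n)) (φ ψ : Sector μ n) :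
    (inner ℂ (permOp μ σ φ) ψ : ℂ) = inner ℂ φ (permOp μ σ⁻¹ ψ) := by
  rw [← (permOp μ σ⁻¹).inner_map_map, permOp_permOp, inv_mul_cancel, permOp_one]

theorem lower_permOp {n : ℕ} (σ : Equiv.Perm (Fin n)) (f : OneParticle μ) (ψ : Sector μ (n + 1)) :
    lower μ n f (permOp μ (Equiv.Perm.decomposeFin.symm (0, σ)) ψ) =
      permOp μ σ (lower μ n f ψ) := by
  apply ext_inner_left ℂ
  intro χ
  have h1 : χ = permOp μ σ (permOp μ σ⁻¹ χ) := by
    rw [permOp_permOp, mul_inv_cancel, permOp_one]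
  conv_rhs => rw [h1]
  rw [LinearIsometry.inner_map_map, lower, ContinuousLinearMap.adjoint_inner_right,
    ContinuousLinearMap.adjoint_inner_right, raise_apply, raise_apply]
  conv_lhs => rw [h1]
  rw [← permOp_tensor, LinearIsometry.inner_map_map]

theorem permOp_tensor_symm {n : ℕ} (σ : Equiv.Perm (Fin n)) (f : OneParticle μ)
    (ψ : SymSector μ n) :
    permOp μ (Equiv.Perm.decomposeFin.symm (0, σ)) (tensor μ f (ψ : Sector μ n)) =
      tensor μ f (ψ : Sector μ n) := by
  rw [permOp_tensor, ψ.2 σ]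

/-- `S (f ⊗ ψ)` is the mean of the exchanges of the first variable of `f ⊗ ψ`. -/
theorem coe_raiseSym (n : ℕ) (f : OneParticle μ) (ψ : SymSector μ n) :
    ((n + 1 : ℕ) : ℂ) • (raiseSym μ n f ψ : Sector μ (n + 1)) =
      ∑ p : Fin (n + 1), permOp μ (Equiv.swap 0 p) (tensor μ f (ψ : Sector μ n)) := by
  have h : (raiseSym μ n f ψ : Sector μ (n + 1)) = (((n + 1).factorial : ℂ)⁻¹) •
      ∑ σ : Equiv.Perm (Fin (n + 1)), permOp μ σ (tensor μ f (ψ : Sector μ n)) :=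
    coe_symmetrize μ (n + 1) _
  rw [h, ← Equiv.Perm.decomposeFin.symm.sum_comp, Fintype.sum_prod_type]
  have h1 : ∀ (p : Fin (n + 1)) (σ : Equiv.Perm (Fin n)),
      permOp μ (Equiv.Perm.decomposeFin.symm (p, σ)) (tensor μ f (ψ : Sector μ n)) =
        permOp μ (Equiv.swap 0 p) (tensor μ f (ψ : Sector μ n)) := by
    intro p σ
    have : Equiv.Perm.decomposeFin.symm (p, σ) =
        Equiv.swap 0 p * Equiv.Perm.decomposeFin.symm (0, σ) := by
      ext i
      refine Fin.cases ?_ (fun i => ?_) i <;> simp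
    rw [this, ← permOp_permOp, permOp_tensor_symm]
  simp only [h1, Finset.sum_const, Finset.card_univ, Fintype.card_perm, Fintype.card_fin]
  rw [← Finset.smul_sum, ← Nat.cast_smul_eq_nsmul ℂ, smul_smul, smul_smul, Nat.factorial_succ]
  have h2 : (n.factorial : ℂ) ≠ 0 := by exact_mod_cast n.factorial_ne_zero
  have h3 : ((n : ℂ) + 1) ≠ 0 := by exact_mod_cast n.succ_ne_zero
  push_cast
  rw [show ((n : ℂ) + 1) * (((n : ℂ) + 1) * n.factorial)⁻¹ * n.factorial = 1 by field_simp,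
    one_smul]

theorem coe_lowerSym (n : ℕ) (f : OneParticle μ) (ψ : SymSector μ (n + 1)) :
    (lowerSym μ n f ψ : Sector μ n) = lower μ n f (ψ : Sector μ (n + 1)) := rfl

theorem lowerSym_raiseSym_zero (f g : OneParticle μ) (ψ : SymSector μ 0) :
    lowerSym μ 0 f (raiseSym μ 0 g ψ) = (inner ℂ f g : ℂ) • ψ := by
  apply Subtype.ext
  have h := coe_raiseSym μ 0 g ψ
  rw [Fin.sum_univ_succ, Finset.univ_eq_empty, Finset.sum_empty, add_zero, Equiv.swap_self,
    show ((0 + 1 : ℕ) : ℂ) = 1 by norm_num, one_smul] at h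
  have h2 : permOp μ (Equiv.refl (Fin (0 + 1))) (tensor μ g (ψ : Sector μ 0)) =
    tensor μ g (ψ : Sector μ 0) := permOp_one μ _
  rw [coe_lowerSym, h, h2, lower_tensor]
  rfl

theorem lowerSym_raiseSym_succ (n : ℕ) (f g : OneParticle μ) (ψ : SymSector μ (n + 1)) :
    ((n + 1 + 1 : ℕ) : ℂ) • lowerSym μ (n + 1) f (raiseSym μ (n + 1) g ψ) =
      (inner ℂ f g : ℂ) • ψ + ((n + 1 : ℕ) : ℂ) • raiseSym μ n g (lowerSym μ n f ψ) := by
  apply Subtype.ext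
  rw [← map_smul]
  rw [coe_lowerSym]
  have e : ((((n + 1 + 1 : ℕ) : ℂ) • raiseSym μ (n + 1) g ψ : SymSector μ (n + 1 + 1)) :
      Sector μ (n + 1 + 1)) = ((n + 1 + 1 : ℕ) : ℂ) • (raiseSym μ (n + 1) g ψ : Sector μ _) := rfl
  have e2 : (((inner ℂ f g : ℂ) • ψ + ((n + 1 : ℕ) : ℂ) • raiseSym μ n g (lowerSym μ n f ψ) :
      SymSector μ (n + 1)) : Sector μ (n + 1)) = (inner ℂ f g : ℂ) • (ψ : Sector μ (n + 1)) +
      ((n + 1 : ℕ) : ℂ) • (raiseSym μ n g (lowerSym μ n f ψ) : Sector μ _) := rfl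
  rw [e, e2, coe_raiseSym, coe_raiseSym, map_sum, Fin.sum_univ_succ, Equiv.swap_self]
  congr 1
  · change lower μ (n + 1) f (permOp μ 1 _) = _
    rw [permOp_one, lower_tensor]
  · refine Finset.sum_congr rfl fun q _ => ?_
    have hq : Equiv.swap (0 : Fin (n + 2)) q.succ =
        Equiv.Perm.decomposeFin.symm (0, Equiv.swap 0 q) * (Equiv.swap 0 1 *
          Equiv.Perm.decomposeFin.symm (0, Equiv.swap 0 q)) := by
      have h1 : (Equiv.Perm.decomposeFin.symm (0, Equiv.swap 0 q) : Equiv.Perm (Fin (n + 2)))⁻¹ =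
          Equiv.Perm.decomposeFin.symm (0, Equiv.swap 0 q) := by
        rw [inv_eq_iff_mul_eq_one]
        ext i
        refine Fin.cases ?_ (fun i => ?_) i <;> simp
      have h2 := Equiv.swap_apply_apply
        (Equiv.Perm.decomposeFin.symm (0, Equiv.swap 0 q) : Equiv.Perm (Fin (n + 2))) 0 1
      rw [h1, mul_assoc] at h2
      have h3 : Equiv.Perm.decomposeFin.symm (0, Equiv.swap 0 q) (0 : Fin (n + 2)) = 0 := by simp
      have h4 : Equiv.Perm.decomposeFin.symm (0, Equiv.swap 0 q) (1 : Fin (n + 2)) = q.succ := by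
        have : (1 : Fin (n + 2)) = Fin.succ 0 := rfl
        rw [this, Equiv.Perm.decomposeFin_symm_apply_succ]
        simp
      rw [← h2, h3, h4]
    rw [hq, ← permOp_permOp, ← permOp_permOp, permOp_tensor_symm, lower_permOp,
      lower_swap_tensor]
    rfl

theorem lowerSym_comm (n : ℕ) (f g : OneParticle μ) (ψ : SymSector μ (n + 2)) :
    lowerSym μ n f (lowerSym μ (n + 1) g ψ) = lowerSym μ n g (lowerSym μ (n + 1) f ψ) := by
  apply Subtype.ext
  simp only [coe_lowerSym]
  apply ext_inner_left ℂ
  intro χ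
  simp only [lower, ContinuousLinearMap.adjoint_inner_right, raise_apply]
  have h : permOp μ (Equiv.swap 0 1) (tensor μ g (tensor μ f χ)) =
      tensor μ f (tensor μ g χ) := by
    apply Lp.ext
    have h1 := (measurePreserving_perm μ (Equiv.swap (0 : Fin (n + 2)) 1)).quasiMeasurePreserving
    filter_upwards [permOp_coeFn μ (Equiv.swap 0 1) (tensor μ g (tensor μ f χ)),
      h1.ae (tensor_coeFn μ g (tensor μ f χ)),
      h1.ae ((quasi_tail μ (n + 1)).ae (tensor_coeFn μ f χ)),
      tensor_coeFn μ f (tensor μ g χ),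
      (quasi_tail μ (n + 1)).ae (tensor_coeFn μ g χ)] with x h1 h2 h3 h4 h5
    rw [h1, h2, h3, h4, h5, Equiv.swap_apply_left]
    have e1 : (Fin.succ 0 : Fin (n + 2)) = 1 := rfl
    have e2 : ∀ i : Fin n, Equiv.swap (0 : Fin (n + 2)) 1 i.succ.succ = i.succ.succ := fun i =>
      Equiv.swap_apply_of_ne_of_ne (Fin.succ_ne_zero _)
        (fun h => Fin.succ_ne_zero i (Fin.succ_injective _ h))
    rw [e1, Equiv.swap_apply_right]
    simp only [e2]
    ring
  rw [← h, inner_permOp_left, ψ.2]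

theorem inner_raiseSym (n : ℕ) (f : OneParticle μ) (φ : SymSector μ n) (ψ : SymSector μ (n + 1)) :
    (inner ℂ (raiseSym μ n f φ) ψ : ℂ) = inner ℂ φ (lowerSym μ n f ψ) := by
  change (inner ℂ (raiseSym μ n f φ : Sector μ (n + 1)) (ψ : Sector μ (n + 1)) : ℂ) =
    inner ℂ (φ : Sector μ n) (lower μ n f (ψ : Sector μ (n + 1)))
  have h : (raiseSym μ n f φ : Sector μ (n + 1)) = (((n + 1).factorial : ℂ)⁻¹) •
      ∑ σ : Equiv.Perm (Fin (n + 1)), permOp μ σ (tensor μ f (φ : Sector μ n)) :=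
    coe_symmetrize μ (n + 1) _
  have h2 : ((n + 1).factorial : ℂ) ≠ 0 := by exact_mod_cast (n + 1).factorial_ne_zero
  rw [h, inner_smul_left, sum_inner]
  simp only [inner_permOp_left, ψ.2 _]
  rw [lower, ContinuousLinearMap.adjoint_inner_right, raise_apply, Finset.sum_const,
    Finset.card_univ, Fintype.card_perm, Fintype.card_fin, nsmul_eq_mul, map_inv₀,
    Complex.conj_natCast, inv_mul_cancel_left₀ h2]

theorem lowerSym_smul (n : ℕ) (c : ℂ) (f : OneParticle μ) :
    lowerSym μ n (c • f) = (starRingEnd ℂ c) • lowerSym μ n f := by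
  ext1 ψ
  apply ext_inner_left ℂ
  intro χ
  have h : raiseSym μ n (c • f) χ = c • raiseSym μ n f χ := by
    change symmetrize μ (n + 1) (tensor μ (c • f) (χ : Sector μ n)) =
      c • symmetrize μ (n + 1) (tensor μ f (χ : Sector μ n))
    rw [← map_smul]
    congr 1
    apply Lp.ext
    have h0 : ∀ᵐ x ∂(Measure.pi (fun _ : Fin (n + 1) => μ)), (c • f) (x 0) = c • f (x 0) :=
      (Measure.quasiMeasurePreserving_fst.comp
        (measurePreserving_cons μ n).quasiMeasurePreserving).ae (Lp.coeFn_smul c f)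
    filter_upwards [tensor_coeFn μ (c • f) (χ : Sector μ n), tensor_coeFn μ f (χ : Sector μ n),
      Lp.coeFn_smul c (tensor μ f (χ : Sector μ n)), h0] with x h1 h2 h3 h4
    rw [h1, h3, Pi.smul_apply, h2, h4, smul_eq_mul, smul_eq_mul, mul_assoc]
  rw [← inner_raiseSym, h, smul_apply]
  have h1 := inner_smul_left (𝕜 := ℂ) (raiseSym μ n f χ) ψ c
  have h2 := inner_smul_right (𝕜 := ℂ) χ (lowerSym μ n f ψ) (starRingEnd ℂ c)
  rw [inner_raiseSym] at h1
  exact h1.trans h2.symm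

theorem raiseSym_smul (n : ℕ) (c : ℂ) (f : OneParticle μ) :
    raiseSym μ n (c • f) = c • raiseSym μ n f := by
  ext1 ψ
  apply ext_inner_right ℂ
  intro χ
  rw [inner_raiseSym, lowerSym_smul, smul_apply, smul_apply]
  have h1 := inner_smul_left (𝕜 := ℂ) (raiseSym μ n f ψ) χ c
  have h2 := inner_smul_right (𝕜 := ℂ) ψ (lowerSym μ n f χ) (starRingEnd ℂ c)
  rw [inner_raiseSym] at h1
  exact h2.trans h1.symm

end SectorCCR


/-! ### Commutators with partial sums of the exponential series -/

section DoubleCommutator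

variable {R : Type*} [Ring R] [Algebra ℂ R]

/-- The partial sums of the exponential series. -/
def expSum (b : R) (K : ℕ) : R := ∑ n ∈ Finset.range K, ((n.factorial : ℂ)⁻¹) • b ^ n

theorem expSum_succ (b : R) (K : ℕ) :
    expSum b (K + 1) = expSum b K + ((K.factorial : ℂ)⁻¹) • b ^ K := Finset.sum_range_succ _ _

theorem mul_pow_of_commutator {a b : R} {c : ℂ} (h : a * b = b * a + c • 1) (n : ℕ) :
    a * b ^ (n + 1) = b ^ (n + 1) * a + (((n + 1 : ℕ) : ℂ) * c) • b ^ n := by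
  induction n with
  | zero => simp [h]
  | succ n ih =>
    have e : ((n + 1 + 1 : ℕ) : ℂ) * c = c + ((n + 1 : ℕ) : ℂ) * c := by
      push_cast
      ring
    rw [pow_succ b (n + 1), ← mul_assoc, ih, add_mul, mul_assoc, h, mul_add, ← mul_assoc,
      smul_mul_assoc, ← pow_succ, ← pow_succ, mul_smul_comm, mul_one, e, add_smul, add_assoc]

theorem mul_expSum_of_commutator {a b : R} {c : ℂ} (h : a * b = b * a + c • 1) (K : ℕ) :
    a * expSum b (K + 1) = expSum b (K + 1) * a + c • expSum b K := by
  induction K with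
  | zero => simp [expSum]
  | succ K ih =>
    rw [expSum_succ b (K + 1), mul_add, ih, add_mul, mul_smul_comm, mul_pow_of_commutator h,
      expSum_succ b K, smul_add, smul_add, smul_mul_assoc, smul_smul, smul_smul,
      show (((K + 1).factorial : ℂ)⁻¹) * (((K + 1 : ℕ) : ℂ) * c) = c * (K.factorial : ℂ)⁻¹ by
        have : ((K : ℂ) + 1) ≠ 0 := by exact_mod_cast K.succ_ne_zero
        have : (K.factorial : ℂ) ≠ 0 := by exact_mod_cast K.factorial_ne_zero
        rw [Nat.factorial_succ]
        push_cast
        field_simp]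
    abel

theorem mul_pow_of_double_commutator {a b d : R} {c : ℂ} (h : a * b = b * a + d)
    (h' : d * b = b * d + (2 * c) • 1) (n : ℕ) :
    a * b ^ (n + 2) = b ^ (n + 2) * a + ((n + 2 : ℕ) : ℂ) • (b ^ (n + 1) * d) +
      (((n + 2 : ℕ) : ℂ) * ((n + 1 : ℕ) : ℂ) * c) • b ^ n := by
  induction n with
  | zero =>
    rw [zero_add, pow_two, ← mul_assoc, h, add_mul, mul_assoc, h, h', mul_add]
    simp only [zero_add, pow_one, pow_zero, Nat.cast_one, Nat.cast_ofNat, mul_one, mul_assoc,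
      two_smul]
    abel
  | succ n ih =>
    rw [pow_succ b (n + 2), ← mul_assoc, ih, add_mul, add_mul, mul_assoc, h, mul_add, ← mul_assoc,
      smul_mul_assoc, mul_assoc _ d, h', mul_add, ← mul_assoc, smul_mul_assoc, ← pow_succ,
      ← pow_succ, ← pow_succ, mul_smul_comm, mul_one, smul_add, smul_smul]
    have e1 : ((n + 1 + 2 : ℕ) : ℂ) = 1 + ((n + 2 : ℕ) : ℂ) := by push_cast; ring
    have e2 : ((n + 1 + 2 : ℕ) : ℂ) * ((n + 1 + 1 : ℕ) : ℂ) * c =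
      ((n + 2 : ℕ) : ℂ) * (2 * c) + ((n + 2 : ℕ) : ℂ) * ((n + 1 : ℕ) : ℂ) * c := by
      push_cast
      ring
    rw [e2, e1, add_smul, add_smul, one_smul]
    abel

theorem mul_expSum_of_double_commutator {a b d : R} {c : ℂ} (h : a * b = b * a + d)
    (h' : d * b = b * d + (2 * c) • 1) (K : ℕ) :
    a * expSum b (K + 2) = expSum b (K + 2) * a + expSum b (K + 1) * d + c • expSum b K := by
  induction K with
  | zero =>
    simp only [expSum, Finset.sum_range_succ, Finset.sum_range_zero]
    simp [h, mul_add, add_mul]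
    abel
  | succ K ih =>
    have h1 : (((K + 2).factorial : ℂ)⁻¹) * ((K + 2 : ℕ) : ℂ) = ((K + 1).factorial : ℂ)⁻¹ := by
      have : ((K : ℂ) + 1 + 1) ≠ 0 := by exact_mod_cast (K + 1).succ_ne_zero
      have : ((K + 1).factorial : ℂ) ≠ 0 := by exact_mod_cast (K + 1).factorial_ne_zero
      rw [Nat.factorial_succ (K + 1)]
      push_cast
      rw [show (K : ℂ) + 2 = K + 1 + 1 by ring]
      field_simp
    have h2 : (((K + 1).factorial : ℂ)⁻¹) * ((K + 1 : ℕ) : ℂ) = (K.factorial : ℂ)⁻¹ := by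
      have : ((K : ℂ) + 1) ≠ 0 := by exact_mod_cast K.succ_ne_zero
      have : (K.factorial : ℂ) ≠ 0 := by exact_mod_cast K.factorial_ne_zero
      rw [Nat.factorial_succ]
      push_cast
      field_simp
    have e1 : expSum b (K + 1 + 1) * d =
        expSum b (K + 1) * d + (((K + 1).factorial : ℂ)⁻¹) • (b ^ (K + 1) * d) := by
      rw [expSum_succ, add_mul, smul_mul_assoc]
    have e2 : c • expSum b (K + 1) = c • expSum b K + (c * (K.factorial : ℂ)⁻¹) • b ^ K := by
      rw [expSum_succ, smul_add, smul_smul]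
    have e3 : expSum b (K + 1 + 2) =
      expSum b (K + 2) + (((K + 2).factorial : ℂ)⁻¹) • b ^ (K + 2) := expSum_succ b (K + 2)
    rw [e1, e2, e3, mul_add, ih, add_mul, mul_smul_comm, mul_pow_of_double_commutator h h',
      smul_add, smul_add, smul_mul_assoc, smul_smul, smul_smul, ← mul_assoc, ← mul_assoc, h1, h2,
      mul_comm _ c]
    abel

end DoubleCommutator

section Commutator

variable {R : Type*} [Ring R]

theorem commutator_sub {a b c z : R} (hc : a * c = c * a + z) (hb : a * b = b * a) :
    a * (c - b) = (c - b) * a + z := by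
  rw [mul_sub, sub_mul, hc, hb]
  abel

theorem commutator_sub_of_grading {a b c : R} (hc : a * c = c * a + c) (hb : a * b = b * a - b) :
    a * (c - b) = (c - b) * a + (b + c) := by
  rw [mul_sub, sub_mul, hc, hb]
  abel

theorem commutator_add_sub [Algebra ℂ R] {b c : R} {z : ℂ} (h : b * c = c * b + z • 1) :
    (b + c) * (c - b) = (c - b) * (b + c) + (2 * z) • 1 := by
  rw [add_mul, mul_sub, mul_sub, sub_mul, mul_add, mul_add, h, two_mul, add_smul]
  abel

end Commutator

/-! ### Vectors with finitely many particles -/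

section FiniteVectors

variable {X : Type*} [MeasurableSpace X] {μ : Measure X} [SigmaFinite μ]

theorem sqrt_smul_sqrt_smul {M : Type*} [AddCommGroup M] [Module ℂ M] (n : ℕ) (v : M) :
    ((Real.sqrt (n : ℝ) : ℝ) : ℂ) • ((Real.sqrt (n : ℝ) : ℝ) : ℂ) • v = (n : ℂ) • v := by
  rw [smul_smul, ← Complex.ofReal_mul, Real.mul_self_sqrt (Nat.cast_nonneg n),
    Complex.ofReal_natCast]

variable (μ) in
/-- Finite sequences of bosonic vectors. -/
def FiniteSeq : Submodule ℂ ((n : ℕ) → SymSector μ n) where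
  carrier := {ψ | ∃ M, ∀ n, M < n → ψ n = 0}
  add_mem' := by
    rintro φ ψ ⟨M, hM⟩ ⟨M', hM'⟩
    refine ⟨max M M', fun n hn => ?_⟩
    rw [Pi.add_apply, hM n ((le_max_left _ _).trans_lt hn), hM' n ((le_max_right _ _).trans_lt hn),
      add_zero]
  zero_mem' := ⟨0, fun _ _ => rfl⟩
  smul_mem' := by
    rintro c ψ ⟨M, hM⟩
    exact ⟨M, fun n hn => by rw [Pi.smul_apply, hM n hn, smul_zero]⟩

/-- The annihilation operator on finite vectors. -/
def annFin (f : OneParticle μ) : Module.End ℂ (FiniteSeq μ) where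
  toFun ψ := ⟨fun n => ((Real.sqrt ((n + 1 : ℕ) : ℝ) : ℝ) : ℂ) • lowerSym μ n f (ψ.1 (n + 1)), by
    obtain ⟨M, hM⟩ := ψ.2
    exact ⟨M, fun n hn => by
      change ((Real.sqrt ((n + 1 : ℕ) : ℝ) : ℝ) : ℂ) • lowerSym μ n f (ψ.1 (n + 1)) = 0
      rw [hM (n + 1) (by omega), map_zero, smul_zero]⟩⟩
  map_add' φ ψ := by
    apply Subtype.ext
    funext n
    change ((Real.sqrt ((n + 1 : ℕ) : ℝ) : ℝ) : ℂ) • lowerSym μ n f (φ.1 (n + 1) + ψ.1 (n + 1)) =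
      ((Real.sqrt ((n + 1 : ℕ) : ℝ) : ℝ) : ℂ) • lowerSym μ n f (φ.1 (n + 1)) +
        ((Real.sqrt ((n + 1 : ℕ) : ℝ) : ℝ) : ℂ) • lowerSym μ n f (ψ.1 (n + 1))
    rw [map_add, smul_add]
  map_smul' c ψ := by
    apply Subtype.ext
    funext n
    change ((Real.sqrt ((n + 1 : ℕ) : ℝ) : ℝ) : ℂ) • lowerSym μ n f (c • ψ.1 (n + 1)) =
      c • ((Real.sqrt ((n + 1 : ℕ) : ℝ) : ℝ) : ℂ) • lowerSym μ n f (ψ.1 (n + 1))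
    rw [map_smul, smul_comm]

/-- The components of `a*(f) ψ`. -/
def creFinSeq (f : OneParticle μ) (ψ : (n : ℕ) → SymSector μ n) : (n : ℕ) → SymSector μ n
  | 0 => 0
  | n + 1 => ((Real.sqrt ((n + 1 : ℕ) : ℝ) : ℝ) : ℂ) • raiseSym μ n f (ψ n)

/-- The creation operator on finite vectors. -/
def creFin (f : OneParticle μ) : Module.End ℂ (FiniteSeq μ) where
  toFun ψ := ⟨creFinSeq f ψ.1, by
    obtain ⟨M, hM⟩ := ψ.2
    refine ⟨M + 1, fun n hn => ?_⟩
    cases n with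
    | zero => rfl
    | succ n => rw [creFinSeq, hM n (by omega), map_zero, smul_zero]⟩
  map_add' φ ψ := by
    apply Subtype.ext
    funext n
    cases n with
    | zero => exact (add_zero 0).symm
    | succ n =>
      change ((Real.sqrt ((n + 1 : ℕ) : ℝ) : ℝ) : ℂ) • raiseSym μ n f (φ.1 n + ψ.1 n) =
        ((Real.sqrt ((n + 1 : ℕ) : ℝ) : ℝ) : ℂ) • raiseSym μ n f (φ.1 n) +
          ((Real.sqrt ((n + 1 : ℕ) : ℝ) : ℝ) : ℂ) • raiseSym μ n f (ψ.1 n)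
      rw [map_add, smul_add]
  map_smul' c ψ := by
    apply Subtype.ext
    funext n
    cases n with
    | zero => exact (smul_zero c).symm
    | succ n =>
      change ((Real.sqrt ((n + 1 : ℕ) : ℝ) : ℝ) : ℂ) • raiseSym μ n f (c • ψ.1 n) =
        c • ((Real.sqrt ((n + 1 : ℕ) : ℝ) : ℝ) : ℂ) • raiseSym μ n f (ψ.1 n)
      rw [map_smul, smul_comm]

variable (μ) in
/-- The number operator on finite vectors. -/
def numFin : Module.End ℂ (FiniteSeq μ) where
  toFun ψ := ⟨fun n => (n : ℂ) • ψ.1 n, by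
    obtain ⟨M, hM⟩ := ψ.2
    exact ⟨M, fun n hn => by
      change (n : ℂ) • ψ.1 n = 0
      rw [hM n hn, smul_zero]⟩⟩
  map_add' φ ψ := Subtype.ext (funext fun n => smul_add (n : ℂ) (φ.1 n) (ψ.1 n))
  map_smul' c ψ := Subtype.ext (funext fun n => smul_comm (n : ℂ) c (ψ.1 n))

theorem annFin_apply (f : OneParticle μ) (ψ : FiniteSeq μ) (n : ℕ) : (annFin f ψ).1 n =
    ((Real.sqrt ((n + 1 : ℕ) : ℝ) : ℝ) : ℂ) • lowerSym μ n f (ψ.1 (n + 1)) := rfl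

theorem creFin_apply_zero (f : OneParticle μ) (ψ : FiniteSeq μ) : (creFin f ψ).1 0 = 0 := rfl

theorem creFin_apply_succ (f : OneParticle μ) (ψ : FiniteSeq μ) (n : ℕ) :
    (creFin f ψ).1 (n + 1) =
      ((Real.sqrt ((n + 1 : ℕ) : ℝ) : ℝ) : ℂ) • raiseSym μ n f (ψ.1 n) := rfl

theorem numFin_apply (ψ : FiniteSeq μ) (n : ℕ) : (numFin μ ψ).1 n = (n : ℂ) • ψ.1 n := rfl

theorem annFin_mul_creFin (f g : OneParticle μ) :
    annFin f * creFin g = creFin g * annFin f + (inner ℂ f g : ℂ) • 1 := by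
  ext1 ψ
  apply Subtype.ext
  funext n
  change (annFin f (creFin g ψ)).1 n = (creFin g (annFin f ψ)).1 n + (inner ℂ f g : ℂ) • ψ.1 n
  rw [annFin_apply, creFin_apply_succ, map_smul, sqrt_smul_sqrt_smul]
  cases n with
  | zero =>
    rw [creFin_apply_zero, lowerSym_raiseSym_zero, zero_add, zero_add, Nat.cast_one, one_smul]
  | succ n =>
    rw [creFin_apply_succ, annFin_apply, map_smul, sqrt_smul_sqrt_smul, lowerSym_raiseSym_succ]
    exact add_comm _ _

theorem annFin_mul_annFin (f g : OneParticle μ) : annFin f * annFin g = annFin g * annFin f := by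
  ext1 ψ
  apply Subtype.ext
  funext n
  change (annFin f (annFin g ψ)).1 n = (annFin g (annFin f ψ)).1 n
  rw [annFin_apply, annFin_apply, annFin_apply, annFin_apply, map_smul, map_smul, lowerSym_comm]

theorem numFin_mul_creFin (f : OneParticle μ) :
    numFin μ * creFin f = creFin f * numFin μ + creFin f := by
  ext1 ψ
  apply Subtype.ext
  funext n
  change (numFin μ (creFin f ψ)).1 n = (creFin f (numFin μ ψ)).1 n + (creFin f ψ).1 n
  rw [numFin_apply]
  cases n with
  | zero => rw [creFin_apply_zero, creFin_apply_zero, smul_zero, add_zero]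
  | succ n =>
    rw [creFin_apply_succ, creFin_apply_succ, numFin_apply, map_smul, ← smul_add, smul_comm]
    push_cast
    rw [add_smul, one_smul]

theorem numFin_mul_annFin (f : OneParticle μ) :
    numFin μ * annFin f = annFin f * numFin μ - annFin f := by
  ext1 ψ
  apply Subtype.ext
  funext n
  change (numFin μ (annFin f ψ)).1 n = (annFin f (numFin μ ψ)).1 n - (annFin f ψ).1 n
  rw [numFin_apply, annFin_apply, annFin_apply, numFin_apply, map_smul, ← smul_sub, smul_comm]
  push_cast
  rw [add_smul, one_smul, add_sub_cancel_right]

/-- The generator `a*(f) - a(f)` of the Weyl operators on finite vectors. -/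
def genFin (f : OneParticle μ) : Module.End ℂ (FiniteSeq μ) := creFin f - annFin f

theorem annFin_mul_genFin (f g : OneParticle μ) :
    annFin g * genFin f = genFin f * annFin g + (inner ℂ g f : ℂ) • 1 :=
  commutator_sub (R := Module.End ℂ (FiniteSeq μ)) (annFin_mul_creFin g f) (annFin_mul_annFin g f)

theorem numFin_mul_genFin (f : OneParticle μ) :
    numFin μ * genFin f = genFin f * numFin μ + (annFin f + creFin f) :=
  commutator_sub_of_grading (R := Module.End ℂ (FiniteSeq μ)) (numFin_mul_creFin f) (numFin_mul_annFin f)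

theorem fieldFin_mul_genFin (f : OneParticle μ) :
    (annFin f + creFin f) * genFin f = genFin f * (annFin f + creFin f) +
      (2 * (inner ℂ f f : ℂ)) • 1 :=
  commutator_add_sub (R := Module.End ℂ (FiniteSeq μ)) (annFin_mul_creFin f f)

theorem genFin_vanish (f : OneParticle μ) {ψ : FiniteSeq μ} {M : ℕ} (h : ∀ n, M < n → ψ.1 n = 0)
    (n : ℕ) (hn : M + 1 < n) : (genFin f ψ).1 n = 0 := by
  change (creFin f ψ).1 n - (annFin f ψ).1 n = 0
  rw [annFin_apply, h (n + 1) (by omega), map_zero, smul_zero, sub_zero]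
  cases n with
  | zero => rfl
  | succ n => rw [creFin_apply_succ, h n (by omega), map_zero, smul_zero]

end FiniteVectors


/-! ### Values of partially defined operators -/

section Values

variable {E : Type*} [NormedAddCommGroup E] [InnerProductSpace ℂ E]

theorem value_of_mem {A : E →ₗ.[ℂ] E} {ψ : E} (h : ψ ∈ A.domain) : value A ψ = A ⟨ψ, h⟩ :=
  dif_pos h

theorem value_sub {A : E →ₗ.[ℂ] E} {φ ψ : E} (hφ : φ ∈ A.domain) (hψ : ψ ∈ A.domain) :
    value A (φ - ψ) = value A φ - value A ψ := by
  rw [value_of_mem hφ, value_of_mem hψ, value_of_mem (A.domain.sub_mem hφ hψ), ← LinearPMap.map_sub]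
  rfl

theorem value_sum_apply {A B : E →ₗ.[ℂ] E} {ψ : E} (hA : ψ ∈ A.domain) (hB : ψ ∈ B.domain) :
    value (A + B) ψ = value A ψ + value B ψ := by
  rw [value_of_mem hA, value_of_mem hB, value_of_mem (show ψ ∈ (A + B).domain from ⟨hA, hB⟩)]
  rfl

end Values

section FockOperators

variable {X : Type*} [MeasurableSpace X] {μ : Measure X} [SigmaFinite μ]

theorem hasSum_norm_sq (ψ : Fock μ) : HasSum (fun n => ‖ψ n‖ ^ 2) (‖ψ‖ ^ 2) := by
  have h := lp.hasSum_norm (p := 2) (by norm_num) ψ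
  simpa using h

theorem value_numberFun_apply {w : ℕ → ℝ} {ψ : Fock μ} (h : ψ ∈ (numberFun (μ := μ) w).domain)
    (n : ℕ) : value (numberFun w) ψ n = (w n : ℂ) • ψ n := by
  rw [value_of_mem h]
  rfl

theorem value_sqrtNumber_apply {ψ : Fock μ} (h : ψ ∈ (sqrtNumber (μ := μ)).domain) (n : ℕ) :
    value sqrtNumber ψ n = ((Real.sqrt n : ℝ) : ℂ) • ψ n :=
  value_numberFun_apply h n

theorem value_number_apply {ψ : Fock μ} (h : ψ ∈ (number (μ := μ)).domain) (n : ℕ) :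
    value number ψ n = (n : ℂ) • ψ n := by
  rw [number, value_numberFun_apply h, Complex.ofReal_natCast]

theorem value_annihilation_apply (f : OneParticle μ) {ψ : Fock μ}
    (h : ψ ∈ (sqrtNumber (μ := μ)).domain) (n : ℕ) :
    value (annihilation f) ψ n =
      ((Real.sqrt ((n + 1 : ℕ) : ℝ) : ℝ) : ℂ) • lowerSym μ n f (ψ (n + 1)) := by
  rw [value_of_mem (A := annihilation f) h]
  rfl

theorem value_creation_zero (f : OneParticle μ) {ψ : Fock μ}
    (h : ψ ∈ (sqrtNumber (μ := μ)).domain) : value (creation f) ψ 0 = 0 := by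
  rw [value_of_mem (A := creation f) h]
  rfl

theorem value_creation_succ (f : OneParticle μ) {ψ : Fock μ}
    (h : ψ ∈ (sqrtNumber (μ := μ)).domain) (n : ℕ) :
    value (creation f) ψ (n + 1) =
      ((Real.sqrt ((n + 1 : ℕ) : ℝ) : ℝ) : ℂ) • raiseSym μ n f (ψ n) := by
  rw [value_of_mem (A := creation f) h]
  rfl

theorem hasSum_norm_sqrtNumber_sq {ψ : Fock μ} (h : ψ ∈ (sqrtNumber (μ := μ)).domain) :
    HasSum (fun n : ℕ => (n : ℝ) * ‖ψ n‖ ^ 2) (‖value sqrtNumber ψ‖ ^ 2) := by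
  refine (hasSum_norm_sq (value sqrtNumber ψ)).congr_fun fun n => ?_
  rw [value_sqrtNumber_apply h, norm_sqrt_smul_sq]

theorem norm_annihilation_le (f : OneParticle μ) {ψ : Fock μ}
    (h : ψ ∈ (sqrtNumber (μ := μ)).domain) :
    ‖value (annihilation f) ψ‖ ≤ ‖f‖ * ‖value sqrtNumber ψ‖ := by
  refine le_of_pow_le_pow_left₀ two_ne_zero (by positivity) ?_
  have h1 := hasSum_norm_sqrtNumber_sq h
  have h2 := ((hasSum_nat_add_iff' 1).2 h1).mul_left (‖f‖ ^ 2)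
  simp only [Finset.sum_range_one, Nat.cast_zero, zero_mul, sub_zero] at h2
  rw [mul_pow]
  refine hasSum_le (fun n => ?_) (hasSum_norm_sq (value (annihilation f) ψ)) h2
  rw [value_annihilation_apply f h, norm_sqrt_smul_sq]
  have h3 := pow_le_pow_left₀ (norm_nonneg _) (norm_lowerSym_apply_le μ n f (ψ (n + 1))) 2
  calc ((n + 1 : ℕ) : ℝ) * ‖lowerSym μ n f (ψ (n + 1))‖ ^ 2
      ≤ ((n + 1 : ℕ) : ℝ) * (‖f‖ * ‖ψ (n + 1)‖) ^ 2 := by gcongr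
    _ = ‖f‖ ^ 2 * (((n + 1 : ℕ) : ℝ) * ‖ψ (n + 1)‖ ^ 2) := by ring

theorem norm_creation_sq_le (f : OneParticle μ) {ψ : Fock μ}
    (h : ψ ∈ (sqrtNumber (μ := μ)).domain) :
    ‖value (creation f) ψ‖ ^ 2 ≤ ‖f‖ ^ 2 * (‖value sqrtNumber ψ‖ ^ 2 + ‖ψ‖ ^ 2) := by
  have h1 := ((hasSum_norm_sqrtNumber_sq h).add (hasSum_norm_sq ψ)).mul_left (‖f‖ ^ 2)
  have h2 := (hasSum_nat_add_iff' 1).2 (hasSum_norm_sq (value (creation f) ψ))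
  rw [Finset.sum_range_one, value_creation_zero f h, norm_zero, zero_pow two_ne_zero,
    sub_zero] at h2
  refine hasSum_le (fun n => ?_) h2 h1
  rw [value_creation_succ f h, norm_sqrt_smul_sq]
  have h3 := pow_le_pow_left₀ (norm_nonneg _) (norm_raiseSym_apply_le μ n f (ψ n)) 2
  calc ((n + 1 : ℕ) : ℝ) * ‖raiseSym μ n f (ψ n)‖ ^ 2
      ≤ ((n + 1 : ℕ) : ℝ) * (‖f‖ * ‖ψ n‖) ^ 2 := by gcongr
    _ = ‖f‖ ^ 2 * ((n : ℝ) * ‖ψ n‖ ^ 2 + ‖ψ n‖ ^ 2) := by push_cast; ring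

theorem norm_creation_le (f : OneParticle μ) {ψ : Fock μ}
    (h : ψ ∈ (sqrtNumber (μ := μ)).domain) :
    ‖value (creation f) ψ‖ ≤ ‖f‖ * (‖value sqrtNumber ψ‖ + ‖ψ‖) := by
  refine le_of_pow_le_pow_left₀ two_ne_zero (by positivity) ((norm_creation_sq_le f h).trans ?_)
  rw [mul_pow]
  gcongr
  nlinarith [norm_nonneg ψ, norm_nonneg (value sqrtNumber ψ)]

theorem inner_creation_left (f : OneParticle μ) {φ ψ : Fock μ}
    (hφ : φ ∈ (sqrtNumber (μ := μ)).domain) (hψ : ψ ∈ (sqrtNumber (μ := μ)).domain) :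
    (inner ℂ (value (creation f) φ) ψ : ℂ) = inner ℂ φ (value (annihilation f) ψ) := by
  have h1 := (hasSum_nat_add_iff' 1).2 (lp.hasSum_inner (𝕜 := ℂ) (value (creation f) φ) ψ)
  rw [Finset.sum_range_one, value_creation_zero f hφ, inner_zero_left, sub_zero] at h1
  refine h1.unique ((lp.hasSum_inner (𝕜 := ℂ) φ (value (annihilation f) ψ)).congr_fun fun n => ?_)
  rw [value_creation_succ f hφ, value_annihilation_apply f hψ]
  have h2 := inner_smul_left (𝕜 := ℂ) (raiseSym μ n f (φ n)) (ψ (n + 1))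
    ((Real.sqrt ((n + 1 : ℕ) : ℝ) : ℝ) : ℂ)
  have h3 := inner_smul_right (𝕜 := ℂ) (φ n) (lowerSym μ n f (ψ (n + 1)))
    ((Real.sqrt ((n + 1 : ℕ) : ℝ) : ℝ) : ℂ)
  rw [Complex.conj_ofReal, inner_raiseSym] at h2
  exact h2.trans h3.symm

theorem mem_sqrtNumber_of_mem_number {ψ : Fock μ} (h : ψ ∈ (number (μ := μ)).domain) :
    ψ ∈ (sqrtNumber (μ := μ)).domain := by
  have h1 := (memlp_two_iff _).1 h
  refine (memlp_two_iff _).2 (Summable.of_nonneg_of_le (fun n => by positivity) (fun n => ?_) h1)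
  rw [norm_sqrt_smul_sq, norm_smul, mul_pow, Complex.norm_real, Real.norm_natCast]
  gcongr
  exact_mod_cast Nat.le_self_pow two_ne_zero n

theorem tendsto_apply {ι : Type*} {l : Filter ι} {u : ι → Fock μ} {ψ : Fock μ}
    (h : Tendsto u l (𝓝 ψ)) (n : ℕ) : Tendsto (fun i => u i n) l (𝓝 (ψ n)) := by
  rw [tendsto_iff_norm_sub_tendsto_zero] at h ⊢
  exact squeeze_zero (fun _ => norm_nonneg _)
    (fun i => lp.norm_apply_le_norm (p := 2) (by norm_num) (u i - ψ) n) h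

/-- `w(𝒩)` is closed. -/
theorem numberFun_closed {w : ℕ → ℝ} {ι : Type*} {l : Filter ι} [l.NeBot] {u : ι → Fock μ}
    {ψ η : Fock μ} (hu : ∀ i, u i ∈ (numberFun (μ := μ) w).domain) (hψ : Tendsto u l (𝓝 ψ))
    (hη : Tendsto (fun i => value (numberFun w) (u i)) l (𝓝 η)) :
    ψ ∈ (numberFun (μ := μ) w).domain ∧ value (numberFun w) ψ = η := by
  have h : ∀ n, (w n : ℂ) • ψ n = η n := fun n => by
    refine tendsto_nhds_unique ((tendsto_apply hψ n).const_smul (w n : ℂ)) ?_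
    refine (tendsto_apply hη n).congr fun i => ?_
    rw [value_numberFun_apply (hu i)]
  have hm : ψ ∈ (numberFun (μ := μ) w).domain := by
    change Memℓp (fun n => (w n : ℂ) • ψ n) 2
    rw [show (fun n => (w n : ℂ) • ψ n) = η from funext h]
    exact lp.memℓp η
  refine ⟨hm, lp.ext (funext fun n => ?_)⟩
  rw [value_numberFun_apply hm, h]

/-- The graph of `a(g)` is closed in `D(𝒩^{1/2})`. -/
theorem annihilation_closed (g : OneParticle μ) {ι : Type*} {l : Filter ι} [l.NeBot]
    {u : ι → Fock μ} {ψ η : Fock μ} (hu : ∀ i, u i ∈ (sqrtNumber (μ := μ)).domain)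
    (hm : ψ ∈ (sqrtNumber (μ := μ)).domain) (hψ : Tendsto u l (𝓝 ψ))
    (hη : Tendsto (fun i => value (annihilation g) (u i)) l (𝓝 η)) :
    value (annihilation g) ψ = η := by
  refine lp.ext (funext fun n => ?_)
  rw [value_annihilation_apply g hm]
  refine tendsto_nhds_unique ((((lowerSym μ n g).continuous.tendsto _).comp
    (tendsto_apply hψ (n + 1))).const_smul _) ((tendsto_apply hη n).congr fun i => ?_)
  rw [value_annihilation_apply g (hu i)]
  rfl

theorem value_annihilation_smul (c : ℂ) (f : OneParticle μ) {ψ : Fock μ}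
    (h : ψ ∈ (sqrtNumber (μ := μ)).domain) :
    value (annihilation (c • f)) ψ = (starRingEnd ℂ c) • value (annihilation f) ψ := by
  refine lp.ext (funext fun n => ?_)
  rw [lp.coeFn_smul, Pi.smul_apply, value_annihilation_apply _ h, value_annihilation_apply _ h,
    lowerSym_smul, smul_apply, smul_comm]

theorem value_creation_smul (c : ℂ) (f : OneParticle μ) {ψ : Fock μ}
    (h : ψ ∈ (sqrtNumber (μ := μ)).domain) :
    value (creation (c • f)) ψ = c • value (creation f) ψ := by
  refine lp.ext (funext fun n => ?_)
  rw [lp.coeFn_smul, Pi.smul_apply]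
  cases n with
  | zero => rw [value_creation_zero _ h, value_creation_zero _ h, smul_zero]
  | succ n =>
    rw [value_creation_succ _ h, value_creation_succ _ h, raiseSym_smul, smul_apply, smul_comm]

theorem value_field (f : OneParticle μ) {ψ : Fock μ} (h : ψ ∈ (sqrtNumber (μ := μ)).domain) :
    value (field f) ψ = value (annihilation f) ψ + value (creation f) ψ :=
  value_sum_apply (A := annihilation f) (B := creation f) h h

theorem mem_field {f : OneParticle μ} {ψ : Fock μ} :
    ψ ∈ (field f).domain ↔ ψ ∈ (sqrtNumber (μ := μ)).domain :=
  ⟨fun h => h.1, fun h => ⟨h, h⟩⟩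

/-- `-i φ(i f) = a*(f) - a(f)`. -/
theorem neg_I_smul_field (f : OneParticle μ) {ψ : Fock μ}
    (h : ψ ∈ (sqrtNumber (μ := μ)).domain) :
    -Complex.I • value (field (Complex.I • f)) ψ =
      value (creation f) ψ - value (annihilation f) ψ := by
  rw [value_field _ h, value_annihilation_smul _ _ h, value_creation_smul _ _ h, smul_add,
    smul_smul, smul_smul, Complex.conj_I]
  simp only [neg_mul, mul_neg, neg_neg, Complex.I_mul_I, one_smul, neg_smul]
  abel

/-! ### Finite vectors in the Fock space -/

theorem memlp_finiteSeq (ψ : FiniteSeq μ) : Memℓp ψ.1 2 := by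
  obtain ⟨M, hM⟩ := ψ.2
  rw [memlp_two_iff]
  refine summable_of_ne_finset_zero (s := Finset.range (M + 1)) fun n hn => ?_
  rw [Finset.mem_range] at hn
  rw [hM n (by omega), norm_zero, zero_pow two_ne_zero]

/-- The embedding of the finite vectors into the Fock space. -/
def toFock : FiniteSeq μ →ₗ[ℂ] Fock μ where
  toFun ψ := ⟨ψ.1, memlp_finiteSeq ψ⟩
  map_add' _ _ := rfl
  map_smul' _ _ := rfl

theorem toFock_apply (ψ : FiniteSeq μ) (n : ℕ) : toFock ψ n = ψ.1 n := rfl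

theorem toFock_mem_numberFun (w : ℕ → ℝ) (ψ : FiniteSeq μ) :
    toFock ψ ∈ (numberFun (μ := μ) w).domain := by
  obtain ⟨M, hM⟩ := ψ.2
  refine (memlp_two_iff _).2 ?_
  refine summable_of_ne_finset_zero (s := Finset.range (M + 1)) fun n hn => ?_
  rw [Finset.mem_range] at hn
  rw [toFock_apply, hM n (by omega), smul_zero, norm_zero, zero_pow two_ne_zero]

theorem toFock_mem_sqrtNumber (ψ : FiniteSeq μ) : toFock ψ ∈ (sqrtNumber (μ := μ)).domain :=
  toFock_mem_numberFun _ ψ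

theorem toFock_mem_number (ψ : FiniteSeq μ) : toFock ψ ∈ (number (μ := μ)).domain :=
  toFock_mem_numberFun _ ψ

theorem value_number_toFock (ψ : FiniteSeq μ) : value number (toFock ψ) = toFock (numFin μ ψ) :=
  lp.ext (funext fun n => value_number_apply (toFock_mem_number ψ) n)

theorem value_annihilation_toFock (f : OneParticle μ) (ψ : FiniteSeq μ) :
    value (annihilation f) (toFock ψ) = toFock (annFin f ψ) :=
  lp.ext (funext fun n => value_annihilation_apply f (toFock_mem_sqrtNumber ψ) n)

theorem value_creation_toFock (f : OneParticle μ) (ψ : FiniteSeq μ) :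
    value (creation f) (toFock ψ) = toFock (creFin f ψ) := by
  refine lp.ext (funext fun n => ?_)
  cases n with
  | zero => exact value_creation_zero f (toFock_mem_sqrtNumber ψ)
  | succ n => exact value_creation_succ f (toFock_mem_sqrtNumber ψ) n

theorem toFock_genFin (f : OneParticle μ) (ψ : FiniteSeq μ) :
    toFock (genFin f ψ) = value (creation f) (toFock ψ) - value (annihilation f) (toFock ψ) := by
  rw [value_creation_toFock, value_annihilation_toFock, ← map_sub]
  rfl

theorem genFin_skew (f : OneParticle μ) (φ ψ : FiniteSeq μ) :
    (inner ℂ (toFock (genFin f φ)) (toFock ψ) : ℂ) =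
      -inner ℂ (toFock φ) (toFock (genFin f ψ)) := by
  have h1 := toFock_mem_sqrtNumber φ
  have h2 := toFock_mem_sqrtNumber ψ
  rw [toFock_genFin, toFock_genFin, inner_sub_left, inner_sub_right, inner_creation_left f h1 h2,
    ← inner_conj_symm (toFock φ) (value (creation f) (toFock ψ)), inner_creation_left f h2 h1,
    inner_conj_symm]
  ring

theorem norm_sqrtNumber_toFock_le {ψ : FiniteSeq μ} {M : ℕ} (h : ∀ n, M < n → ψ.1 n = 0) :
    ‖value sqrtNumber (toFock ψ)‖ ≤ Real.sqrt M * ‖toFock ψ‖ := by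
  refine le_of_pow_le_pow_left₀ two_ne_zero (by positivity) ?_
  rw [mul_pow, Real.sq_sqrt (Nat.cast_nonneg M)]
  refine hasSum_le (fun n => ?_) (hasSum_norm_sqrtNumber_sq (toFock_mem_sqrtNumber ψ))
    ((hasSum_norm_sq (toFock ψ)).mul_left (M : ℝ))
  by_cases hn : M < n
  · rw [toFock_apply, h n hn]
    simp
  · have : (n : ℝ) ≤ M := by exact_mod_cast not_lt.1 hn
    gcongr

theorem norm_genFin_le (f : OneParticle μ) {ψ : FiniteSeq μ} {M : ℕ}
    (h : ∀ n, M < n → ψ.1 n = 0) :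
    ‖toFock (genFin f ψ)‖ ≤ 3 * ‖f‖ * Real.sqrt (M + 1 : ℕ) * ‖toFock ψ‖ := by
  have h0 := toFock_mem_sqrtNumber ψ
  have h1 := norm_sqrtNumber_toFock_le h
  have h2 : Real.sqrt M ≤ Real.sqrt (M + 1 : ℕ) := Real.sqrt_le_sqrt (by push_cast; linarith)
  have h3 : 1 ≤ Real.sqrt (M + 1 : ℕ) :=
    Real.one_le_sqrt.2 (by push_cast; linarith [M.cast_nonneg (α := ℝ)])
  have h4 : ‖value sqrtNumber (toFock ψ)‖ ≤ Real.sqrt (M + 1 : ℕ) * ‖toFock ψ‖ :=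
    h1.trans (by gcongr)
  have h5 : ‖toFock ψ‖ ≤ Real.sqrt (M + 1 : ℕ) * ‖toFock ψ‖ :=
    le_mul_of_one_le_left (norm_nonneg _) h3
  rw [toFock_genFin]
  calc _ ≤ ‖f‖ * (‖value sqrtNumber (toFock ψ)‖ + ‖toFock ψ‖) +
        ‖f‖ * ‖value sqrtNumber (toFock ψ)‖ :=
        (norm_sub_le _ _).trans (add_le_add (norm_creation_le f h0) (norm_annihilation_le f h0))
    _ ≤ ‖f‖ * (Real.sqrt (M + 1 : ℕ) * ‖toFock ψ‖ + Real.sqrt (M + 1 : ℕ) * ‖toFock ψ‖) +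
        ‖f‖ * (Real.sqrt (M + 1 : ℕ) * ‖toFock ψ‖) := by gcongr
    _ = _ := by ring

theorem expSummable_genFin (f : OneParticle μ) (ψ : FiniteSeq μ) :
    ExpSummable fun n => toFock ((genFin f ^ n) ψ) := by
  obtain ⟨M, hM⟩ := ψ.2
  have hv : ∀ k n, M + k < n → ((genFin f ^ k) ψ).1 n = 0 := by
    intro k
    induction k with
    | zero => exact hM
    | succ k ih =>
      intro n hn
      rw [pow_succ', Module.End.mul_apply]
      exact genFin_vanish f ih n hn
  intro r
  have hlim : Tendsto (fun n : ℕ => |r| * (3 * ‖f‖) * (Real.sqrt (M + n + 1 : ℕ) / (n + 1 : ℕ)))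
      atTop (𝓝 0) := by
    have h1 : Tendsto (fun n : ℕ => Real.sqrt (M + n + 1 : ℕ) / (n + 1 : ℕ)) atTop (𝓝 0) := by
      have h2 : Tendsto (fun n : ℕ => Real.sqrt (M + 1 : ℕ) / Real.sqrt (n + 1 : ℕ)) atTop
          (𝓝 0) :=
        tendsto_const_nhds.div_atTop (Real.tendsto_sqrt_atTop.comp
          (tendsto_natCast_atTop_atTop.comp (tendsto_add_atTop_nat 1)))
      refine squeeze_zero (fun _ => by positivity) (fun n => ?_) h2
      have hn : (0 : ℝ) < (n + 1 : ℕ) := by positivity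
      have h3 : Real.sqrt (M + n + 1 : ℕ) ≤ Real.sqrt (M + 1 : ℕ) * Real.sqrt (n + 1 : ℕ) := by
        rw [← Real.sqrt_mul (Nat.cast_nonneg _), ← Nat.cast_mul]
        refine Real.sqrt_le_sqrt (Nat.cast_le.2 ?_)
        rw [add_mul, mul_add]
        omega
      rw [div_le_div_iff₀ hn (Real.sqrt_pos.2 hn)]
      calc Real.sqrt (M + n + 1 : ℕ) * Real.sqrt (n + 1 : ℕ)
          ≤ Real.sqrt (M + 1 : ℕ) * Real.sqrt (n + 1 : ℕ) * Real.sqrt (n + 1 : ℕ) := by gcongr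
        _ = _ := by rw [mul_assoc, Real.mul_self_sqrt hn.le]
    simpa using h1.const_mul (|r| * (3 * ‖f‖))
  refine summable_of_ratio_norm_eventually_le (r := 1 / 2) (by norm_num) ?_
  filter_upwards [hlim.eventually_le_const (show (0 : ℝ) < 1 / 2 by norm_num)] with n hn
  rw [pow_succ' (genFin f), Module.End.mul_apply]
  have hb := norm_genFin_le f (hv n)
  rw [norm_mul, norm_mul, norm_norm, norm_norm, norm_div, norm_div, norm_pow, norm_pow,
    Real.norm_eq_abs, Real.norm_natCast, Real.norm_natCast, Nat.factorial_succ]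
  calc |r| ^ (n + 1) / (((n + 1) * n.factorial : ℕ) : ℝ) * ‖toFock (genFin f ((genFin f ^ n) ψ))‖
      ≤ |r| ^ (n + 1) / (((n + 1) * n.factorial : ℕ) : ℝ) *
        (3 * ‖f‖ * Real.sqrt (M + n + 1 : ℕ) * ‖toFock ((genFin f ^ n) ψ)‖) := by gcongr
    _ = (|r| * (3 * ‖f‖) * (Real.sqrt (M + n + 1 : ℕ) / (n + 1 : ℕ))) *
        (|r| ^ n / n.factorial * ‖toFock ((genFin f ^ n) ψ)‖) := by
      rw [Nat.cast_mul, pow_succ]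
      field_simp
    _ ≤ _ := by gcongr

/-- The restriction of `ψ` to at most `M - 1` particles. -/
def trunc (M : ℕ) (ψ : Fock μ) : FiniteSeq μ :=
  ⟨fun n => if n < M then ψ n else 0, M, fun n hn => if_neg (by omega)⟩

theorem trunc_apply (M : ℕ) (ψ : Fock μ) (n : ℕ) :
    (trunc M ψ).1 n = if n < M then ψ n else 0 := rfl

theorem tendsto_trunc (ψ : Fock μ) : Tendsto (fun M => toFock (trunc M ψ)) atTop (𝓝 ψ) := by
  refine (lp.hasSum_single (p := 2) (by norm_num) ψ).tendsto_sum_nat.congr fun M => ?_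
  refine lp.ext (funext fun n => ?_)
  rw [toFock_apply, trunc_apply, lp.coeFn_sum, Finset.sum_apply]
  split_ifs with h
  · rw [Finset.sum_eq_single n (fun m _ hm => lp.single_apply_ne 2 m _ hm.symm)
      (fun h' => absurd (Finset.mem_range.2 h) h'), lp.single_apply_self]
  · refine Finset.sum_eq_zero fun m hm => lp.single_apply_ne 2 m _ ?_
    rw [Finset.mem_range] at hm
    omega

theorem denseRange_toFock : DenseRange (toFock (μ := μ)) := fun ψ =>
  mem_closure_of_tendsto (tendsto_trunc ψ) (Eventually.of_forall fun M => ⟨trunc M ψ, rfl⟩)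

theorem tendsto_numberFun_trunc {w : ℕ → ℝ} {ψ : Fock μ}
    (h : ψ ∈ (numberFun (μ := μ) w).domain) :
    Tendsto (fun M => value (numberFun w) (toFock (trunc M ψ))) atTop
      (𝓝 (value (numberFun w) ψ)) := by
  refine (tendsto_trunc (value (numberFun w) ψ)).congr fun M => ?_
  refine lp.ext (funext fun n => ?_)
  rw [value_numberFun_apply (toFock_mem_numberFun w _), toFock_apply, toFock_apply, trunc_apply,
    trunc_apply, value_numberFun_apply h]
  split_ifs <;> simp

theorem tendsto_annihilation_trunc (f : OneParticle μ) {ψ : Fock μ}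
    (h : ψ ∈ (sqrtNumber (μ := μ)).domain) :
    Tendsto (fun M => value (annihilation f) (toFock (trunc M ψ))) atTop
      (𝓝 (value (annihilation f) ψ)) := by
  have h1 : Tendsto (fun M => value sqrtNumber (toFock (trunc M ψ))) atTop
    (𝓝 (value sqrtNumber ψ)) := tendsto_numberFun_trunc h
  rw [tendsto_iff_norm_sub_tendsto_zero] at h1 ⊢
  refine squeeze_zero (fun _ => norm_nonneg _) (fun M => ?_) (by simpa using h1.const_mul ‖f‖)
  have hM := toFock_mem_sqrtNumber (trunc M ψ)
  rw [← value_sub (A := annihilation f) hM h, ← value_sub hM h]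
  exact norm_annihilation_le f (Submodule.sub_mem _ hM h)

theorem tendsto_creation_trunc (f : OneParticle μ) {ψ : Fock μ}
    (h : ψ ∈ (sqrtNumber (μ := μ)).domain) :
    Tendsto (fun M => value (creation f) (toFock (trunc M ψ))) atTop
      (𝓝 (value (creation f) ψ)) := by
  have h1 : Tendsto (fun M => value sqrtNumber (toFock (trunc M ψ))) atTop
    (𝓝 (value sqrtNumber ψ)) := tendsto_numberFun_trunc h
  have h2 := tendsto_trunc ψ
  rw [tendsto_iff_norm_sub_tendsto_zero] at h1 h2 ⊢
  refine squeeze_zero (fun _ => norm_nonneg _) (fun M => ?_)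
    (by simpa using (h1.add h2).const_mul ‖f‖)
  have hM := toFock_mem_sqrtNumber (trunc M ψ)
  rw [← value_sub (A := creation f) hM h, ← value_sub hM h]
  exact norm_creation_le f (Submodule.sub_mem _ hM h)

end FockOperators


/-! ### Weyl operators -/

section Weyl

variable {X : Type*} [MeasurableSpace X] {μ : Measure X} [SigmaFinite μ]

theorem exists_weylGroup (f : OneParticle μ) :
    ∃ U : ℝ → Fock μ ≃ₗᵢ[ℂ] Fock μ, IsUnitaryGroupOf (field (Complex.I • f)) U := by
  refine exists_isUnitaryGroupOf denseRange_toFock (genFin_skew f) (expSummable_genFin f)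
    fun ψ => ⟨fun M => trunc M ψ, tendsto_trunc _, ?_⟩
  have h : (ψ : Fock μ) ∈ (sqrtNumber (μ := μ)).domain := mem_field.1 ψ.2
  have h1 := (tendsto_creation_trunc f h).sub (tendsto_annihilation_trunc f h)
  rw [← neg_I_smul_field f h, value_of_mem ψ.2] at h1
  exact h1.congr fun M => (toFock_genFin f _).symm

/-- The exponential series converges to the Weyl operator on finite vectors. -/
theorem tendsto_weyl (f : OneParticle μ) (ψ : FiniteSeq μ) :
    Tendsto (fun K => toFock (expSum (R := Module.End ℂ (FiniteSeq μ)) (genFin f) K ψ)) atTop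
      (𝓝 (weyl f (toFock ψ))) := by
  have hU := (exists_weylGroup f).choose_spec
  have h := hU.tendsto_sum (j := toFock) (B := genFin f) (fun x => ?_) (expSummable_genFin f) ψ
  · have hw : weyl f = (exists_weylGroup f).choose 1 := dif_pos (exists_weylGroup f)
    rw [hw]
    refine h.congr fun K => ?_
    rw [expSum, LinearMap.sum_apply]
    rfl
  · have hx := toFock_mem_sqrtNumber x
    refine ⟨mem_field.2 hx, ?_⟩
    rw [← value_of_mem, neg_I_smul_field f hx, toFock_genFin]

theorem weyl_toFock_number (f : OneParticle μ) (ψ : FiniteSeq μ) :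
    weyl f (toFock ψ) ∈ (number (μ := μ)).domain ∧
      value number (weyl f (toFock ψ)) = weyl f (value number (toFock ψ) +
        value (field f) (toFock ψ) + (inner ℂ f f : ℂ) • toFock ψ) := by
  have hid := mul_expSum_of_double_commutator (R := Module.End ℂ (FiniteSeq μ))
    (numFin_mul_genFin f) (fieldFin_mul_genFin f)
  have h2 := (tendsto_add_atTop_iff_nat 2).2 (tendsto_weyl f ψ)
  refine numberFun_closed (fun K => toFock_mem_number _) h2 ?_
  rw [map_add, map_add, map_smul, value_field f (toFock_mem_sqrtNumber ψ), value_number_toFock,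
    value_annihilation_toFock, value_creation_toFock, ← map_add toFock]
  refine ((((tendsto_add_atTop_iff_nat 2).2 (tendsto_weyl f (numFin μ ψ))).add
    ((tendsto_add_atTop_iff_nat 1).2 (tendsto_weyl f (annFin f ψ + creFin f ψ)))).add
    ((tendsto_weyl f ψ).const_smul (inner ℂ f f : ℂ))).congr fun K => ?_
  refine Eq.trans ?_ (value_number_toFock _).symm
  rw [← map_smul, ← map_add, ← map_add]
  exact congrArg toFock (LinearMap.congr_fun (hid K) ψ).symm

theorem weyl_toFock_annihilation (f g : OneParticle μ) (ψ : FiniteSeq μ) :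
    value (annihilation g) (weyl f (toFock ψ)) =
      weyl f (value (annihilation g) (toFock ψ) + (inner ℂ g f : ℂ) • toFock ψ) := by
  have hid := mul_expSum_of_commutator (R := Module.End ℂ (FiniteSeq μ)) (annFin_mul_genFin f g)
  have h2 := (tendsto_add_atTop_iff_nat 1).2 (tendsto_weyl f ψ)
  refine annihilation_closed g (fun K => toFock_mem_sqrtNumber _)
    (mem_sqrtNumber_of_mem_number (weyl_toFock_number f ψ).1) h2 ?_
  rw [map_add, map_smul, value_annihilation_toFock]
  refine (((tendsto_add_atTop_iff_nat 1).2 (tendsto_weyl f (annFin g ψ))).add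
    ((tendsto_weyl f ψ).const_smul (inner ℂ g f : ℂ))).congr fun K => ?_
  rw [value_annihilation_toFock, ← map_smul, ← map_add]
  exact congrArg toFock (LinearMap.congr_fun (hid K) ψ).symm

theorem tendsto_field_trunc (f : OneParticle μ) {ψ : Fock μ}
    (h : ψ ∈ (sqrtNumber (μ := μ)).domain) :
    Tendsto (fun M => value (field f) (toFock (trunc M ψ))) atTop (𝓝 (value (field f) ψ)) := by
  rw [value_field f h]
  exact ((tendsto_annihilation_trunc f h).add (tendsto_creation_trunc f h)).congr fun M =>
    (value_field f (toFock_mem_sqrtNumber _)).symm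

/-- `𝒩 𝒲(f) = 𝒲(f) (𝒩 + φ(f) + ‖f‖²)` on the domain of `𝒩`. -/
theorem weyl_number (f : OneParticle μ) {ψ : Fock μ} (h : ψ ∈ (number (μ := μ)).domain) :
    weyl f ψ ∈ (number (μ := μ)).domain ∧ value number (weyl f ψ) =
      weyl f (value number ψ + value (field f) ψ + (inner ℂ f f : ℂ) • ψ) := by
  have h' := mem_sqrtNumber_of_mem_number h
  refine numberFun_closed (u := fun M => weyl f (toFock (trunc M ψ)))
    (fun M => (weyl_toFock_number f (trunc M ψ)).1)
    (((weyl f).continuous.tendsto _).comp (tendsto_trunc ψ)) ?_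
  have h1 : Tendsto (fun M => value number (toFock (trunc M ψ))) atTop (𝓝 (value number ψ)) :=
    tendsto_numberFun_trunc h
  refine (((weyl f).continuous.tendsto _).comp ((h1.add (tendsto_field_trunc f h')).add
    ((tendsto_trunc ψ).const_smul (inner ℂ f f : ℂ)))).congr fun M => ?_
  exact (weyl_toFock_number f (trunc M ψ)).2.symm

/-- `a(g) 𝒲(f) = 𝒲(f) (a(g) + ⟨g, f⟩)` on the domain of `𝒩`. -/
theorem weyl_annihilation (f g : OneParticle μ) {ψ : Fock μ}
    (h : ψ ∈ (number (μ := μ)).domain) : value (annihilation g) (weyl f ψ) =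
      weyl f (value (annihilation g) ψ + (inner ℂ g f : ℂ) • ψ) := by
  have h' := mem_sqrtNumber_of_mem_number h
  refine annihilation_closed g (u := fun M => weyl f (toFock (trunc M ψ)))
    (fun M => mem_sqrtNumber_of_mem_number (weyl_toFock_number f (trunc M ψ)).1)
    (mem_sqrtNumber_of_mem_number (weyl_number f h).1)
    (((weyl f).continuous.tendsto _).comp (tendsto_trunc ψ)) ?_
  refine (((weyl f).continuous.tendsto _).comp ((tendsto_annihilation_trunc g h').add
    ((tendsto_trunc ψ).const_smul (inner ℂ g f : ℂ)))).congr fun M => ?_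
  exact (weyl_toFock_annihilation f g (trunc M ψ)).symm

/-! ### Expectations and variances in `𝒲(f) Ω` -/

theorem expectation_number {ψ : Fock μ} (h : ψ ∈ (number (μ := μ)).domain) :
    expectation number ψ = ‖value sqrtNumber ψ‖ ^ 2 := by
  have h1 := lp.hasSum_inner (𝕜 := ℂ) ψ (value number ψ)
  have h2 := (Complex.hasSum_re h1)
  refine h2.unique ((hasSum_norm_sqrtNumber_sq (mem_sqrtNumber_of_mem_number h)).congr_fun
    fun n => ?_)
  rw [value_number_apply h]
  have h3 := inner_smul_right (𝕜 := ℂ) (ψ n) (ψ n) (n : ℂ)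
  rw [h3, ← Complex.ofReal_natCast, Complex.re_ofReal_mul]
  exact congrArg (_ * ·) (inner_self_eq_norm_sq (𝕜 := ℂ) (ψ n))

theorem inner_self_field (f : OneParticle μ) {ψ : Fock μ}
    (h : ψ ∈ (sqrtNumber (μ := μ)).domain) :
    (inner ℂ ψ (value (field f) ψ) : ℂ).re = 2 * (inner ℂ ψ (value (annihilation f) ψ) : ℂ).re := by
  rw [value_field f h, inner_add_right, Complex.add_re,
    ← inner_conj_symm ψ (value (creation f) ψ), inner_creation_left f h h, Complex.conj_re]
  ring

omit [SigmaFinite μ] in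
theorem inner_self_ofReal (f : OneParticle μ) : (inner ℂ f f : ℂ) = ((‖f‖ ^ 2 : ℝ) : ℂ) := by
  rw [inner_self_eq_norm_sq_to_K]
  norm_cast

/-- `|𝔼[𝒩] - ‖f‖²| ≤ ‖𝒩^{1/2} Ω‖² + 2 ‖f‖ ‖𝒩^{1/2} Ω‖` in the state `𝒲(f) Ω`. -/
theorem abs_expectation_weyl_sub_le (f : OneParticle μ) {ψ : Fock μ}
    (h : ψ ∈ (number (μ := μ)).domain) (h1 : ‖ψ‖ = 1) :
    |expectation number (weyl f ψ) - ‖f‖ ^ 2| ≤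
      ‖value sqrtNumber ψ‖ ^ 2 + 2 * (‖f‖ * ‖value sqrtNumber ψ‖) := by
  have h' := mem_sqrtNumber_of_mem_number h
  have e : expectation number (weyl f ψ) = ‖value sqrtNumber ψ‖ ^ 2 +
      2 * (inner ℂ ψ (value (annihilation f) ψ) : ℂ).re + ‖f‖ ^ 2 := by
    rw [expectation, (weyl_number f h).2, LinearIsometryEquiv.inner_map_map, inner_add_right,
      inner_add_right, Complex.add_re, Complex.add_re, inner_self_field f h',
      ← expectation_number h, inner_smul_right, inner_self_ofReal, Complex.re_ofReal_mul,
      inner_self_eq_norm_sq_to_K, h1]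
    simp [expectation]
  have h2 : |(inner ℂ ψ (value (annihilation f) ψ) : ℂ).re| ≤ ‖f‖ * ‖value sqrtNumber ψ‖ := by
    refine (Complex.abs_re_le_norm _).trans ((norm_inner_le_norm _ _).trans ?_)
    rw [h1, one_mul]
    exact norm_annihilation_le f h'
  rw [e, add_sub_cancel_right]
  refine (abs_add_le _ _).trans ?_
  rw [abs_mul, abs_two, abs_of_nonneg (sq_nonneg _)]
  linarith

/-- The variance of `𝒩` in `𝒲(f) Ω` is the variance of `𝒩 + φ(f)` in `Ω`. -/
theorem variance_weyl (f : OneParticle μ) {ψ : Fock μ} (h : ψ ∈ (number (μ := μ)).domain)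
    (h1 : ‖ψ‖ = 1) : variance number (weyl f ψ) = variance (number + field f) ψ := by
  have h' := mem_sqrtNumber_of_mem_number h
  have e : value (number + field f) ψ = value number ψ + value (field f) ψ :=
    value_sum_apply h (mem_field.2 h')
  rw [variance, variance, expectation, expectation, (weyl_number f h).2,
    LinearIsometryEquiv.inner_map_map, LinearIsometryEquiv.norm_map, ← e, inner_self_ofReal,
    inner_add_right, inner_smul_right, Complex.add_re, Complex.re_ofReal_mul,
    inner_self_eq_norm_sq_to_K, h1, @norm_add_sq ℂ, norm_smul, inner_smul_right, h1,
    Complex.norm_real, Real.norm_of_nonneg (sq_nonneg _)]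
  have h2 : RCLike.re (((‖f‖ ^ 2 : ℝ) : ℂ) * inner ℂ (value (number + field f) ψ) ψ) =
      ‖f‖ ^ 2 * (inner ℂ ψ (value (number + field f) ψ) : ℂ).re := by
    rw [← inner_conj_symm]
    change Complex.re _ = _
    rw [Complex.re_ofReal_mul, Complex.conj_re]
  rw [h2]
  simp
  ring

/-- `‖(a(g) - ⟨g, f⟩) 𝒲(f) Ω‖ ≤ ‖g‖ ‖𝒩^{1/2} Ω‖`. -/
theorem norm_annihilation_weyl_sub_le (f g : OneParticle μ) {ψ : Fock μ}
    (h : ψ ∈ (number (μ := μ)).domain) :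
    ‖value (annihilation g) (weyl f ψ) - (inner ℂ g f : ℂ) • weyl f ψ‖ ≤
      ‖g‖ * ‖value sqrtNumber ψ‖ := by
  rw [weyl_annihilation f g h, map_add, map_smul, add_sub_cancel_right,
    LinearIsometryEquiv.norm_map]
  exact norm_annihilation_le g (mem_sqrtNumber_of_mem_number h)

end Weyl

/-! ### Iterated limits -/

section IteratedLimits

theorem iteratedLimitZero_iff {q : ℝ → ℝ → ℝ} (hq : ∀ ρ L, 0 ≤ q ρ L) :
    IteratedLimitZero q ↔ ∀ ε > 0, ∀ᶠ ρ in atTop, ∀ᶠ L in atTop, q ρ L < ε := by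
  rw [IteratedLimitZero]
  constructor
  · intro h ε hε
    have hε' : (0 : EReal) < ((ε : ℝ) : EReal) := EReal.coe_pos.2 hε
    filter_upwards [h.eventually_lt_const hε'] with ρ hρ
    filter_upwards [eventually_lt_of_limsup_lt hρ] with L hL
    exact EReal.coe_lt_coe_iff.1 hL
  · intro h
    refine tendsto_order.2 ⟨fun a ha => Eventually.of_forall fun ρ => ha.trans_le ?_,
      fun a ha => ?_⟩
    · exact le_limsup_of_frequently_le (Eventually.of_forall fun L =>
        EReal.coe_nonneg.2 (hq ρ L)).frequently
    · obtain ⟨ε, hε, hεa⟩ := EReal.lt_iff_exists_real_btwn.1 ha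
      filter_upwards [h ε (EReal.coe_pos.1 hε)] with ρ hρ
      refine lt_of_le_of_lt (limsup_le_of_le (h := ?_)) hεa
      filter_upwards [hρ] with L hL
      exact EReal.coe_le_coe_iff.2 hL.le

/-- A quantity that is small whenever `p` is small tends to zero if `p` does. -/
theorem IteratedLimitZero.of_small {p q : ℝ → ℝ → ℝ} (hp : ∀ ρ L, 0 ≤ p ρ L)
    (hq : ∀ ρ L, 0 ≤ q ρ L) (h : IteratedLimitZero p)
    (hpq : ∀ ε > 0, ∃ δ > 0, ∀ ρ L, 0 < ρ → 0 < L → p ρ L < δ → q ρ L < ε) :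
    IteratedLimitZero q := by
  rw [iteratedLimitZero_iff hp] at h
  rw [iteratedLimitZero_iff hq]
  intro ε hε
  obtain ⟨δ, hδ, h1⟩ := hpq ε hε
  filter_upwards [h δ hδ, eventually_gt_atTop 0] with ρ hρ hρ0
  filter_upwards [hρ, eventually_gt_atTop 0] with L hL hL0
  exact h1 ρ L hρ0 hL0 hL

end IteratedLimits

section Main

variable {f : (ρ L : ℝ) → BoxL2 L} {Ω : (ρ L : ℝ) → BoxFock L}

theorem IsQuasiVacuum.abs_expectation_le (hΩ : IsQuasiVacuum f Ω) {ρ L : ℝ} (hρ : 0 < ρ)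
    (hL : 0 < L) :
    |expectation number (weyl (f ρ L) (Ω ρ L)) / ‖f ρ L‖ ^ 2 - 1| ≤
      (‖value sqrtNumber (Ω ρ L)‖ / ‖f ρ L‖) ^ 2 +
        2 * (‖value sqrtNumber (Ω ρ L)‖ / ‖f ρ L‖) := by
  have hf : 0 < ‖f ρ L‖ := norm_pos_iff.2 (hΩ.ne_zero ρ L hρ hL)
  have h := abs_expectation_weyl_sub_le (f ρ L) (hΩ.mem_domain ρ L hρ hL)
    (hΩ.norm_eq_one ρ L hρ hL)
  have e : expectation number (weyl (f ρ L) (Ω ρ L)) / ‖f ρ L‖ ^ 2 - 1 =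
      (expectation number (weyl (f ρ L) (Ω ρ L)) - ‖f ρ L‖ ^ 2) / ‖f ρ L‖ ^ 2 := by
    field_simp
  rw [e, abs_div, abs_of_pos (pow_pos hf 2), div_le_iff₀ (pow_pos hf 2)]
  refine h.trans (le_of_eq ?_)
  field_simp

theorem IsQuasiVacuum.expectation_close (hΩ : IsQuasiVacuum f Ω) :
    IteratedLimitZero fun ρ L =>
      |expectation number (weyl (f ρ L) (Ω ρ L)) / ‖f ρ L‖ ^ 2 - 1| := by
  refine hΩ.number_small.of_small (fun _ _ => by positivity) (fun _ _ => abs_nonneg _)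
    fun ε hε => ⟨min 1 (ε / 3), by positivity, fun ρ L hρ hL hx => ?_⟩
  refine (hΩ.abs_expectation_le hρ hL).trans_lt ?_
  have hx0 : 0 ≤ ‖value sqrtNumber (Ω ρ L)‖ / ‖f ρ L‖ := by positivity
  have h1 := hx.trans_le (min_le_left _ _)
  have h2 := hx.trans_le (min_le_right _ _)
  nlinarith

theorem le_two_mul_of_sq_div_sq {x c r : ℝ} (hc : 0 ≤ c) (hr : 0 < r) (hx : 0 ≤ x)
    (hx' : x < 1 / 6) (h : -(x ^ 2 + 2 * x) ≤ c ^ 2 / r ^ 2 - 1) : r ≤ 2 * c := by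
  have h1 : 1 / 4 ≤ c ^ 2 / r ^ 2 := by nlinarith
  rw [le_div_iff₀ (pow_pos hr 2)] at h1
  refine le_of_pow_le_pow_left₀ two_ne_zero (by positivity) ?_
  rw [mul_pow]
  linarith

/-- `𝒲(f) Ω` is a quasi-eigenstate of every annihilation operator. -/
theorem IsQuasiVacuum.isQuasiEigenstate (hΩ : IsQuasiVacuum f Ω) {g : (ρ L : ℝ) → BoxL2 L}
    (hg : ∀ ρ L : ℝ, 0 < ρ → 0 < L → ‖g ρ L‖ = 1) :
    IsQuasiEigenstate g (fun ρ L => weyl (f ρ L) (Ω ρ L))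
      (fun ρ L => inner ℂ (g ρ L) (f ρ L)) := by
  refine hΩ.number_small.of_small (fun _ _ => by positivity) (fun _ _ => by positivity)
    fun ε hε => ⟨min (1 / 6) (ε / 2), by positivity, fun ρ L hρ hL hx => ?_⟩
  have hf : 0 < ‖f ρ L‖ := norm_pos_iff.2 (hΩ.ne_zero ρ L hρ hL)
  have hdom := hΩ.mem_domain ρ L hρ hL
  have hx0 : 0 ≤ ‖value sqrtNumber (Ω ρ L)‖ / ‖f ρ L‖ := by positivity
  have h1 := hx.trans_le (min_le_left _ _)
  have h2 := hx.trans_le (min_le_right _ _)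
  have hE := (abs_le.1 (hΩ.abs_expectation_le hρ hL)).1
  rw [expectation_number (weyl_number _ hdom).1] at hE
  have hlow' := le_two_mul_of_sq_div_sq (norm_nonneg _) hf hx0 h1 hE
  have hpos : 0 < ‖value sqrtNumber (weyl (f ρ L) (Ω ρ L))‖ := by linarith
  rw [div_lt_iff₀ hf] at h2
  rw [div_lt_iff₀ hpos]
  have h3 := norm_annihilation_weyl_sub_le (f ρ L) (g ρ L) hdom
  rw [hg ρ L hρ hL, one_mul] at h3
  calc _ ≤ ‖value sqrtNumber (Ω ρ L)‖ := h3
    _ < ε / 2 * ‖f ρ L‖ := h2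
    _ ≤ ε / 2 * (2 * ‖value sqrtNumber (weyl (f ρ L) (Ω ρ L))‖) := by gcongr
    _ = _ := by ring

theorem IsQuasiVacuum.isQuasiCoherent (hΩ : IsQuasiVacuum f Ω)
    (hf : ∀ ρ L : ℝ, 0 < ρ → 0 < L → ‖f ρ L‖ ^ 2 = ρ * L ^ 3) :
    IsQuasiCoherent fun ρ L => weyl (f ρ L) (Ω ρ L) where
  mem_domain ρ L hρ hL := (weyl_number _ (hΩ.mem_domain ρ L hρ hL)).1
  norm_eq_one ρ L hρ hL := by
    rw [LinearIsometryEquiv.norm_map]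
    exact hΩ.norm_eq_one ρ L hρ hL
  expectation_close := hΩ.expectation_close.of_small (fun _ _ => abs_nonneg _)
    (fun _ _ => abs_nonneg _) fun ε hε => ⟨ε, hε, fun ρ L hρ hL h => by
      rwa [← hf ρ L hρ hL, one_div_mul_eq_div]⟩
  variance_close := hΩ.variance_close.of_small (fun _ _ => abs_nonneg _)
    (fun _ _ => abs_nonneg _) fun ε hε => ⟨ε, hε, fun ρ L hρ hL h => by
      rwa [← hf ρ L hρ hL, one_div_mul_eq_div, variance_weyl _ (hΩ.mem_domain ρ L hρ hL)
        (hΩ.norm_eq_one ρ L hρ hL)]⟩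

end Main

end BoseFock

end

theorem mainTheorem9
    (f : (ρ L : ℝ) → BoseFock.BoxL2 L)
    (hf : ∀ ρ L : ℝ, 0 < ρ → 0 < L → ‖f ρ L‖ ^ 2 = ρ * L ^ 3)
    (Ω : (ρ L : ℝ) → BoseFock.BoxFock L)
    (hΩ : BoseFock.IsQuasiVacuum f Ω) :
    BoseFock.IsQuasiCanonicalCoherent (fun ρ L => BoseFock.weyl (f ρ L) (Ω ρ L)) ∧
      ∀ g : (ρ L : ℝ) → BoseFock.BoxL2 L,
        (∀ ρ L : ℝ, 0 < ρ → 0 < L → ‖g ρ L‖ = 1) →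
          BoseFock.IsQuasiEigenstate g (fun ρ L => BoseFock.weyl (f ρ L) (Ω ρ L))
            (fun ρ L => inner ℂ (g ρ L) (f ρ L)) :=
  ⟨{ hΩ.isQuasiCoherent hf with
      exists_quasiEigenvalue := fun _ hg => ⟨_, hΩ.isQuasiEigenstate hg⟩ },
    fun _ hg => hΩ.isQuasiEigenstate hg⟩
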